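/- **Setting.** Concepts of LE-$\mathcal{ALC}$ are $C ::= D \mid C_1\wedge C_2\mid C_1\vee C_2\mid \langle R_\Diamond\rangle C\mid [R_\Box]C$ with $D$ atomic. An ABox $\mathcal A$ is a finite collection of terms $bIy$, $bR_\Box y$, $yR_\Diamond b$, $b:C$, $y::C$ and negations of such terms ($b$ an object name, $y$ a feature name); $|\mathcal A|$ is its number of symbols, a name counting as one symbol. Interpretations are over enriched formal contexts $(A,X,I,R_\Box,R_\Diamond)$ with $R_\Box\subseteq A\times X$ and $R_\Diamond\subseteq X\times A$ both $I$-compatible: $\{a: aR_\Box x\}$, $\{x: aR_\Box x\}$, $\{x: xR_\Diamond a\}$, $\{a: xR_\Diamond a\}$ are Galois-stable for all $a\in A$, $x\in X$. Object (feature) names denote elements of $A$ ($X$) and concepts denote formal concepts, where $\wedge,\vee$ are meet and join in the concept lattice, $[R_\Box]C$ has extension $\{a:\forall x\,(x\in \text{intension of }C\Rightarrow aR_\Box x)\}$ and $\langle R_\Diamond\rangle C$ has intension $\{x:\forall a\,(a\in\text{extension of }C\Rightarrow xR_\Diamond a)\}$. The term $b:C$ (resp. $y::C$) holds if $b$ (resp.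 $y$) is in the extension (resp. intension) of $C$. In the axioms below, $p$ ranges over the domain ($X$, resp. $A$) of the model. **Tableaux.** A tableau is a finite collection of assertions over the names of $\mathcal A$ and new names $a_C,x_C$ (one pair for each concept $C$), $\Diamond b,\blacklozenge b$ (objects, for objects $b$) and $\Box y,\blacksquare y$ (features, for features $y$), all distinct except that $\Diamond a_C=a_{\langle R_\Diamond\rangle C}$ and $\Box x_C=x_{[R_\Box]C}$. A concept occurs in a tableau $\mathcal T$ if it is a subformula of some $C$ with $b:C$, $y::C$, $\neg(b:C)$ or $\neg(y::C)$ in $\mathcal T$. The LE-$\mathcal{ALC}$ rules are: for $C$ occurring in $\mathcal T$ add $a_C:C$ and $x_C::C$; from $b:C,\ y::C$ infer $bIy$; from $b:C_1\wedge C_2$ infer $b:C_1,\ b:C_2$; from $y::C_1\vee C_2$ infer $y::C_1,\ y::C_2$; from $b:[R_\Box]C,\ y::C$ infer $bR_\Box y$; from $y::\langle R_\Diamond\rangle C,\ b:C$ infer $yR_\Diamond b$; from $bI\Box y$, or from $\blacklozenge bIy$, infer $bR_\Box y$; from $bI\blacksquare y$, or from $\Diamond bIy$, infer $yR_\Diamond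 b$; from $b:C_1,\ b:C_2$, if $C_1\wedge C_2$ occurs, infer $b:C_1\wedge C_2$; from $y::C_1,\ y::C_2$, if $C_1\vee C_2$ occurs, infer $y::C_1\vee C_2$; from $bR_\Box y$ infer $\blacklozenge bIy,\ bI\Box y$; from $yR_\Diamond b$ infer $\Diamond bIy,\ bI\blacksquare y$; from $\neg(b:C)$ infer $\neg(bIx_C)$; from $\neg(y::C)$ infer $\neg(a_CIy)$; from $bIx_C$ infer $b:C$; from $a_CIy$ infer $y::C$. A clash is a pair $\beta,\neg\beta$ in $\mathcal T$ with $\beta$ of the form $bIy$, $bR_\Box y$ or $yR_\Diamond b$. The algorithm starts with $\mathcal A$ and repeats: if there is a clash, answer "inconsistent"; otherwise, if some rule instance would add a new assertion, choose any such instance and add its conclusions; otherwise answer "consistent". **Theorem.** For a fixed object name $b$ add to these rules $SA(R_\Box,R_\Diamond,b)$: from $bR_\Box y$ infer $yR_\Diamond b$ (for every feature $y$ of the tableau), or, for a fixed feature name $y$, add instead $SX(R_\Diamond,R_\Box,y)$: from $yR_\Diamond b$ infer $bR_\Box y$ (for every object $b$ of the tableau). In either case, the resulting algorithm is a polynomial-time,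 sound and complete decision procedure for the consistency of $\mathcal A\cup\{\forall p\,(bR_\Box p\Rightarrow pR_\Diamond b)\}$, resp. of $\mathcal A\cup\{\forall p\,(yR_\Diamond p\Rightarrow pR_\Box y)\}$. That is, there is a polynomial $P$ such that for every ABox $\mathcal A$: every run of the algorithm on $\mathcal A$, whatever rule instances are chosen, takes at most $P(|\mathcal A|)$ elementary steps, counting the clash tests and the search for applicable rule instances; every run can be continued until it halts; and every halting run answers "consistent" if and only if $\mathcal A$ together with the axiom has a model. -/

import Mathlib

/-! # The description logic LE-ALC, its tableaux rules, and a timed tableaux algorithm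

Individual names and atomic concept names are arbitrary types `O` (objects), `F` (features) and
`D` (atomic concepts). A name counts as one symbol. -/

namespace LEALC

/-! ## Syntax -/

/-- LE-ALC concepts: atomic concepts, meets, joins, `[R_□] C` and `⟨R_◇⟩ C`. -/
inductive LEConcept (D : Type) : Type
  | atom : D → LEConcept D
  | and : LEConcept D → LEConcept D → LEConcept D
  | or : LEConcept D → LEConcept D → LEConcept D
  | box : LEConcept D → LEConcept D
  | dia : LEConcept D → LEConcept D

/-- The five kinds of positive ABox terms. -/
inductive Term (O F D : Type) : Type
  /-- `b I y` -/
  | inc : O → F → Term O F D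
  /-- `b R_□ y` -/
  | rbox : O → F → Term O F D
  /-- `y R_◇ b` -/
  | rdia : F → O → Term O F D
  /-- `b : C` -/
  | obj : O → LEConcept D → Term O F D
  /-- `y :: C` -/
  | feat : F → LEConcept D → Term O F D

/-- ABox assertions: positive terms and their negations. -/
inductive Assertion (O F D : Type) : Type
  | pos : Term O F D → Assertion O F D
  | neg : Term O F D → Assertion O F D

/-- An ABox is a finite collection of assertions. -/
abbrev ABox (O F D : Type) : Type := List (Assertion O F D)

/-- Number of symbols of a concept. -/
def LEConcept.size {D : Type} : LEConcept D → ℕ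
  | .atom _ => 1
  | .and C₁ C₂ => C₁.size + C₂.size + 1
  | .or C₁ C₂ => C₁.size + C₂.size + 1
  | .box C => C.size + 1
  | .dia C => C.size + 1

/-- Number of symbols of a positive term. -/
def Term.size {O F D : Type} : Term O F D → ℕ
  | .inc _ _ => 3
  | .rbox _ _ => 3
  | .rdia _ _ => 3
  | .obj _ C => C.size + 2
  | .feat _ C => C.size + 2

/-- Number of symbols of an assertion. -/
def Assertion.size {O F D : Type} : Assertion O F D → ℕ
  | .pos t => t.size
  | .neg t => t.size + 1

/-- The size `|A|` of an ABox. -/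
def ABox.size {O F D : Type} (A : ABox O F D) : ℕ :=
  (A.map Assertion.size).sum

/-- The two additional axioms, each for one individual name:
`SA b` is `∀ p (b R_□ p ⇒ p R_◇ b)`, and `SX y` is `∀ p (y R_◇ p ⇒ p R_□ y)`. -/
inductive LocalInverse (O F : Type) : Type
  | SA : O → LocalInverse O F
  | SX : F → LocalInverse O F

/-! ## Semantics

`lowerPolar R V` is `R⁽⁰⁾[V]`, `upperPolar R U` is `R⁽¹⁾[U]`, and `Concept A X I` is the lattice of
formal concepts of the polarity `(A, X, I)`. `Order.IsExtent I` and `Order.IsIntent I` are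
Galois-stability of sets of objects and of features. -/

/-- Enriched formal contexts: polarities with `I`-compatible relations `R_□` and `R_◇`. -/
structure EnrichedContext where
  A : Type
  X : Type
  I : A → X → Prop
  Rbox : A → X → Prop
  Rdia : X → A → Prop
  rbox_extent : ∀ x, Order.IsExtent I {a | Rbox a x}
  rbox_intent : ∀ a, Order.IsIntent I {x | Rbox a x}
  rdia_intent : ∀ a, Order.IsIntent I {x | Rdia x a}
  rdia_extent : ∀ x, Order.IsExtent I {a | Rdia x a}

namespace EnrichedContext

theorem isExtent_lowerPolar_rbox (P : EnrichedContext) (V : Set P.X) :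
    Order.IsExtent P.I (lowerPolar P.Rbox V) := by
  have h : lowerPolar P.Rbox V = ⋂ x ∈ V, {a | P.Rbox a x} := by
    ext a; simp [mem_lowerPolar_iff]
  rw [h]
  exact Order.IsExtent.iInter₂ _ fun x _ => P.rbox_extent x

theorem isIntent_lowerPolar_rdia (P : EnrichedContext) (U : Set P.A) :
    Order.IsIntent P.I (lowerPolar P.Rdia U) := by
  have h : lowerPolar P.Rdia U = ⋂ a ∈ U, {x | P.Rdia x a} := by
    ext x; simp [mem_lowerPolar_iff]
  rw [h]
  exact Order.IsIntent.iInter₂ _ fun a _ => P.rdia_intent a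

/-- `[R_□] c`, with extension `R_□⁽⁰⁾[intent c]`. -/
def boxOp (P : EnrichedContext) (c : Concept P.A P.X P.I) : Concept P.A P.X P.I :=
  Concept.ofIsExtent P.I (lowerPolar P.Rbox c.intent) (P.isExtent_lowerPolar_rbox _)

/-- `⟨R_◇⟩ c`, with intension `R_◇⁽⁰⁾[extent c]`. -/
def diaOp (P : EnrichedContext) (c : Concept P.A P.X P.I) : Concept P.A P.X P.I :=
  Concept.ofIsIntent P.I (lowerPolar P.Rdia c.extent) (P.isIntent_lowerPolar_rdia _)

end EnrichedContext

/-- Interpretations of the language with names from `O`, `F`, `D`. -/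
structure Interpretation (O F D : Type) where
  ctx : EnrichedContext
  obj : O → ctx.A
  feat : F → ctx.X
  atom : D → Concept ctx.A ctx.X ctx.I

namespace Interpretation

variable {O F D : Type} (M : Interpretation O F D)

/-- The interpretation of a concept. -/
def eval : LEConcept D → Concept M.ctx.A M.ctx.X M.ctx.I
  | .atom d => M.atom d
  | .and C₁ C₂ => eval C₁ ⊓ eval C₂
  | .or C₁ C₂ => eval C₁ ⊔ eval C₂
  | .box C => M.ctx.boxOp (eval C)
  | .dia C => M.ctx.diaOp (eval C)

/-- `M ⊨ α` for a positive term `α`. -/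
def SatTerm : Term O F D → Prop
  | .inc b y => M.ctx.I (M.obj b) (M.feat y)
  | .rbox b y => M.ctx.Rbox (M.obj b) (M.feat y)
  | .rdia y b => M.ctx.Rdia (M.feat y) (M.obj b)
  | .obj b C => M.obj b ∈ (M.eval C).extent
  | .feat y C => M.feat y ∈ (M.eval C).intent

/-- `M ⊨ α` for an assertion `α`. -/
def Sat : Assertion O F D → Prop
  | .pos t => M.SatTerm t
  | .neg t => ¬ M.SatTerm t

/-- `M` satisfies the additional axiom; `p` runs through the domain of the model. -/
def SatAxiom : LocalInverse O F → Prop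
  | .SA b => ∀ p : M.ctx.X, M.ctx.Rbox (M.obj b) p → M.ctx.Rdia p (M.obj b)
  | .SX y => ∀ p : M.ctx.A, M.ctx.Rdia (M.feat y) p → M.ctx.Rbox p (M.feat y)

end Interpretation

/-- The ABox `A` together with the additional axiom `E` has a model. -/
def Consistent {O F D : Type} (E : LocalInverse O F) (A : ABox O F D) : Prop :=
  ∃ M : Interpretation O F D, (∀ α ∈ A, M.Sat α) ∧ M.SatAxiom E

/-! ## Tableaux -/

/-- Object names of the tableaux: original names, `a_C`, `◆b` and `◇b`. -/
inductive ObjName (O D : Type) : Type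
  | base : O → ObjName O D
  | cls : LEConcept D → ObjName O D
  | bdia : ObjName O D → ObjName O D
  | dia : ObjName O D → ObjName O D

/-- Feature names of the tableaux: original names, `x_C`, `□y` and `■y`. -/
inductive FeatName (F D : Type) : Type
  | base : F → FeatName F D
  | cls : LEConcept D → FeatName F D
  | box : FeatName F D → FeatName F D
  | bbox : FeatName F D → FeatName F D

/-- The name `◇b`, with `◇a_C = a_{◇C}`. -/
def ObjName.mkDia {O D : Type} : ObjName O D → ObjName O D
  | .cls C => .cls (.dia C)
  | b => .dia b

/-- The name `□y`, with `□x_C = x_{□C}`. -/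
def FeatName.mkBox {F D : Type} : FeatName F D → FeatName F D
  | .cls C => .cls (.box C)
  | y => .box y

/-- Assertions over the tableaux names. -/
abbrev TabAssertion (O F D : Type) : Type := Assertion (ObjName O D) (FeatName F D) D

/-- Tableaux: finite collections of assertions over the tableaux names. -/
abbrev Tableau (O F D : Type) : Type := List (TabAssertion O F D)

/-- Replace the names in a term. -/
def Term.map {O O' F F' D : Type} (f : O → O') (g : F → F') : Term O F D → Term O' F' D
  | .inc b y => .inc (f b) (g y)
  | .rbox b y => .rbox (f b) (g y)
  | .rdia y b => .rdia (g y) (f b)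
  | .obj b C => .obj (f b) C
  | .feat y C => .feat (g y) C

/-- An assertion, read as a tableaux assertion. -/
def Assertion.toTab {O F D : Type} : Assertion O F D → TabAssertion O F D
  | .pos t => .pos (t.map .base .base)
  | .neg t => .neg (t.map .base .base)

/-- An ABox, read as the initial tableau. -/
def ABox.toTab {O F D : Type} (A : ABox O F D) : Tableau O F D :=
  A.map Assertion.toTab

/-- `C.Sub C'`: the concept `C'` is a sub-formula of `C`. -/
def LEConcept.Sub {D : Type} : LEConcept D → LEConcept D → Prop
  | .atom d, C' => C' = .atom d
  | .and C₁ C₂, C' => C' = .and C₁ C₂ ∨ C₁.Sub C' ∨ C₂.Sub C'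
  | .or C₁ C₂, C' => C' = .or C₁ C₂ ∨ C₁.Sub C' ∨ C₂.Sub C'
  | .box C, C' => C' = .box C ∨ C.Sub C'
  | .dia C, C' => C' = .dia C ∨ C.Sub C'

/-- The concept, if any, that a term is about. -/
def Term.concept? {O F D : Type} : Term O F D → Option (LEConcept D)
  | .obj _ C => some C
  | .feat _ C => some C
  | _ => none

/-- The concept, if any, that an assertion is about. -/
def Assertion.concept? {O F D : Type} : Assertion O F D → Option (LEConcept D)
  | .pos t => t.concept?
  | .neg t => t.concept?

section Rules

variable {O F D : Type}

/-- The concept `C` occurs in the tableau `T`. -/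
def Occurs (T : Tableau O F D) (C : LEConcept D) : Prop :=
  ∃ α ∈ T, ∃ C', α.concept? = some C' ∧ C'.Sub C

/-- Relational terms. -/
def Term.IsRelational : Term O F D → Prop
  | .inc _ _ => True
  | .rbox _ _ => True
  | .rdia _ _ => True
  | .obj _ _ => False
  | .feat _ _ => False

/-- A clash: `β` and `¬ β` for some relational term `β`. -/
def HasClash (T : Tableau O F D) : Prop :=
  ∃ β, β.IsRelational ∧ Assertion.pos β ∈ T ∧ Assertion.neg β ∈ T

open Assertion Term in
/-- `Rule E T S`: some instance of the LE-ALC expansion rules, or of the additional rule for `E`,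
has all its premises in the tableau `T` and has `S` as its list of conclusions. -/
inductive Rule (E : LocalInverse O F) (T : Tableau O F D) : Tableau O F D → Prop
  -- creation rule
  | create {C} : Occurs T C → Rule E T [pos (obj (.cls C) C), pos (feat (.cls C) C)]
  -- basic rule
  | basic {b y C} : pos (obj b C) ∈ T → pos (feat y C) ∈ T → Rule E T [pos (inc b y)]
  -- rules for the logical connectives
  | and_elim {b C₁ C₂} : pos (obj b (.and C₁ C₂)) ∈ T → Rule E T [pos (obj b C₁), pos (obj b C₂)]
  | or_elim {y C₁ C₂} : pos (feat y (.or C₁ C₂)) ∈ T → Rule E T [pos (feat y C₁), pos (feat y C₂)]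
  | box {b y C} : pos (obj b (.box C)) ∈ T → pos (feat y C) ∈ T → Rule E T [pos (rbox b y)]
  | dia {b y C} : pos (feat y (.dia C)) ∈ T → pos (obj b C) ∈ T → Rule E T [pos (rdia y b)]
  -- compatibility rules
  | of_box {b y} : pos (inc b y.mkBox) ∈ T → Rule E T [pos (rbox b y)]
  | of_bbox {b y} : pos (inc b (.bbox y)) ∈ T → Rule E T [pos (rdia y b)]
  | of_dia {b y} : pos (inc b.mkDia y) ∈ T → Rule E T [pos (rdia y b)]
  | of_bdia {b y} : pos (inc (.bdia b) y) ∈ T → Rule E T [pos (rbox b y)]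
  -- inverse rules for connectives
  | and_intro {b C₁ C₂} : pos (obj b C₁) ∈ T → pos (obj b C₂) ∈ T → Occurs T (.and C₁ C₂) →
      Rule E T [pos (obj b (.and C₁ C₂))]
  | or_intro {y C₁ C₂} : pos (feat y C₁) ∈ T → pos (feat y C₂) ∈ T → Occurs T (.or C₁ C₂) →
      Rule E T [pos (feat y (.or C₁ C₂))]
  -- adjunction rules
  | adj_box {b y} : pos (rbox b y) ∈ T → Rule E T [pos (inc (.bdia b) y), pos (inc b y.mkBox)]
  | adj_dia {b y} : pos (rdia y b) ∈ T → Rule E T [pos (inc b.mkDia y), pos (inc b (.bbox y))]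
  -- basic rules for negative assertions
  | neg_obj {b C} : neg (obj b C) ∈ T → Rule E T [neg (inc b (.cls C))]
  | neg_feat {y C} : neg (feat y C) ∈ T → Rule E T [neg (inc (.cls C) y)]
  -- appending rules
  | app_feat {b C} : pos (inc b (.cls C)) ∈ T → Rule E T [pos (obj b C)]
  | app_obj {y C} : pos (inc (.cls C) y) ∈ T → Rule E T [pos (feat y C)]
  -- the additional rules
  | SA {b y} : E = .SA b → pos (rbox (.base b) y) ∈ T → Rule E T [pos (rdia y (.base b))]
  | SX {b y} : E = .SX y → pos (rdia (.base y) b) ∈ T → Rule E T [pos (rbox b (.base y))]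

/-- An instance of a rule is applicable if it adds at least one new assertion. -/
def Applicable (E : LocalInverse O F) (T S : Tableau O F D) : Prop :=
  Rule E T S ∧ ¬ S ⊆ T

end Rules

/-! ## Step counting

A computation returns a value together with the number of its elementary steps. An elementary step
is the inspection of a bounded number of constructors or the comparison of two names, with the
construction of boundedly many new nodes. Every recursive call below costs at least one step. -/

/-- A value with the number of elementary steps spent on it. -/
structure Timed (α : Type) : Type where
  val : α
  cost : ℕ

namespace Timed

instance : Monad Timed where
  pure a := ⟨a, 0⟩
  bind x f := ⟨(f x.val).val, x.cost + (f x.val).cost⟩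

/-- One elementary step. -/
def tick : Timed Unit := ⟨(), 1⟩

@[simp] theorem val_pure {α : Type} (a : α) : (pure a : Timed α).val = a := rfl

@[simp] theorem val_bind {α β : Type} (x : Timed α) (f : α → Timed β) :
    (x >>= f).val = (f x.val).val := rfl

@[simp] theorem val_ite {α : Type} (c : Prop) [Decidable c] (x y : Timed α) :
    (if c then x else y).val = if c then x.val else y.val := by
  split <;> rfl

end Timed

open Timed

section Program

variable {O F D : Type}

/-- Concatenation of lists, linear in the first list. -/
def appendT {α : Type} : List α → List α → Timed (List α)
  | [], l => do tick; return l
  | a :: k, l => do tick; return a :: (← appendT k l)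

/-- The concatenation of the lists `f a` for `a` in the list. -/
def flatMapT {α β : Type} (f : α → Timed (List β)) : List α → Timed (List β)
  | [] => do tick; return []
  | a :: l => do tick; appendT (← f a) (← flatMapT f l)

/-- The elements of the list that pass the test `f`. -/
def filterT {α : Type} (f : α → Timed Bool) : List α → Timed (List α)
  | [] => do tick; return []
  | a :: l => do tick; if ← f a then return a :: (← filterT f l) else filterT f l

/-- Does some element of the list pass the test `f`? -/
def anyT {α : Type} (f : α → Timed Bool) : List α → Timed Bool
  | [] => do tick; return false
  | a :: l => do tick; if ← f a then return true else anyT f l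

variable [DecidableEq O] [DecidableEq F] [DecidableEq D]

/-- Equality test for concepts, node by node. -/
def LEConcept.eqT : LEConcept D → LEConcept D → Timed Bool
  | .atom d, .atom d' => do tick; return decide (d = d')
  | .and C₁ C₂, .and C₁' C₂' => do tick; if ← C₁.eqT C₁' then C₂.eqT C₂' else return false
  | .or C₁ C₂, .or C₁' C₂' => do tick; if ← C₁.eqT C₁' then C₂.eqT C₂' else return false
  | .box C, .box C' => do tick; C.eqT C'
  | .dia C, .dia C' => do tick; C.eqT C'
  | _, _ => do tick; return false

/-- Equality test for object names. -/
def ObjName.eqT : ObjName O D → ObjName O D → Timed Bool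
  | .base b, .base b' => do tick; return decide (b = b')
  | .cls C, .cls C' => do tick; C.eqT C'
  | .bdia b, .bdia b' => do tick; b.eqT b'
  | .dia b, .dia b' => do tick; b.eqT b'
  | _, _ => do tick; return false

/-- Equality test for feature names. -/
def FeatName.eqT : FeatName F D → FeatName F D → Timed Bool
  | .base y, .base y' => do tick; return decide (y = y')
  | .cls C, .cls C' => do tick; C.eqT C'
  | .box y, .box y' => do tick; y.eqT y'
  | .bbox y, .bbox y' => do tick; y.eqT y'
  | _, _ => do tick; return false

/-- Equality test for terms. -/
def Term.eqT : Term (ObjName O D) (FeatName F D) D → Term (ObjName O D) (FeatName F D) D →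
    Timed Bool
  | .inc b y, .inc b' y' => do tick; if ← b.eqT b' then y.eqT y' else return false
  | .rbox b y, .rbox b' y' => do tick; if ← b.eqT b' then y.eqT y' else return false
  | .rdia y b, .rdia y' b' => do tick; if ← b.eqT b' then y.eqT y' else return false
  | .obj b C, .obj b' C' => do tick; if ← b.eqT b' then C.eqT C' else return false
  | .feat y C, .feat y' C' => do tick; if ← y.eqT y' then C.eqT C' else return false
  | _, _ => do tick; return false

/-- Equality test for assertions. -/
def Assertion.eqT : TabAssertion O F D → TabAssertion O F D → Timed Bool
  | .pos t, .pos t' => do tick; t.eqT t'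
  | .neg t, .neg t' => do tick; t.eqT t'
  | _, _ => do tick; return false

/-- Membership test. -/
def memT (α : TabAssertion O F D) (T : Tableau O F D) : Timed Bool :=
  anyT (fun β => α.eqT β) T

/-- Is some assertion of `S` missing in `T`? -/
def newT (T S : Tableau O F D) : Timed Bool :=
  anyT (fun α => do if ← memT α T then return false else return true) S

/-- Clash test. -/
def clashT (T : Tableau O F D) : Timed Bool :=
  anyT (fun α => do
    tick
    match α with
    | .neg (.inc b y) => memT (.pos (.inc b y)) T
    | .neg (.rbox b y) => memT (.pos (.rbox b y)) T
    | .neg (.rdia y b) => memT (.pos (.rdia y b)) T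
    | _ => return false) T

/-- The sub-formulas of a concept, put in front of a list. -/
def LEConcept.subT : LEConcept D → List (LEConcept D) → Timed (List (LEConcept D))
  | .atom d, l => do tick; return .atom d :: l
  | .and C₁ C₂, l => do tick; return .and C₁ C₂ :: (← C₁.subT (← C₂.subT l))
  | .or C₁ C₂, l => do tick; return .or C₁ C₂ :: (← C₁.subT (← C₂.subT l))
  | .box C, l => do tick; return .box C :: (← C.subT l)
  | .dia C, l => do tick; return .dia C :: (← C.subT l)

/-- The concepts that occur in a tableau. -/
def occursT (T : Tableau O F D) : Timed (List (LEConcept D)) :=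
  flatMapT (fun α => do
    tick
    match α.concept? with
    | some C => C.subT []
    | none => return []) T

/-- Conclusions from `b I y`, by the form of `y`. -/
def incFeat (b : ObjName O D) : FeatName F D → List (Tableau O F D)
  | .base _ => []
  | .cls (.box C) => [[.pos (.obj b (.box C))], [.pos (.rbox b (.cls C))]]
  | .cls C => [[.pos (.obj b C)]]
  | .box (.cls _) => []
  | .box y => [[.pos (.rbox b y)]]
  | .bbox y => [[.pos (.rdia y b)]]

/-- Conclusions from `b I y`, by the form of `b`. -/
def incObj (y : FeatName F D) : ObjName O D → List (Tableau O F D)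
  | .base _ => []
  | .cls (.dia C) => [[.pos (.feat y (.dia C))], [.pos (.rdia y (.cls C))]]
  | .cls C => [[.pos (.feat y C)]]
  | .dia (.cls _) => []
  | .dia b => [[.pos (.rdia y b)]]
  | .bdia b => [[.pos (.rbox b y)]]

/-- Conclusions of the rule for `SA`. -/
def ruleSA (y : FeatName F D) : LocalInverse O F → ObjName O D → List (Tableau O F D)
  | .SA b, .base b' => if b = b' then [[.pos (.rdia y (.base b'))]] else []
  | _, _ => []

/-- Conclusions of the rule for `SX`. -/
def ruleSX (b : ObjName O D) : LocalInverse O F → FeatName F D → List (Tableau O F D)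
  | .SX y, .base y' => if y = y' then [[.pos (.rbox b (.base y'))]] else []
  | _, _ => []

/-- Conclusions of the rules with one premise. -/
def oneT (E : LocalInverse O F) (α : TabAssertion O F D) : Timed (List (Tableau O F D)) := do
  tick
  match α with
  | .pos (.inc b y) => appendT (incFeat b y) (incObj y b)
  | .pos (.rbox b y) =>
      return [.pos (.inc (.bdia b) y), .pos (.inc b y.mkBox)] :: ruleSA y E b
  | .pos (.rdia y b) =>
      return [.pos (.inc b.mkDia y), .pos (.inc b (.bbox y))] :: ruleSX b E y
  | .pos (.obj b (.and C₁ C₂)) => return [[.pos (.obj b C₁), .pos (.obj b C₂)]]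
  | .pos (.feat y (.or C₁ C₂)) => return [[.pos (.feat y C₁), .pos (.feat y C₂)]]
  | .neg (.obj b C) => return [[.neg (.inc b (.cls C))]]
  | .neg (.feat y C) => return [[.neg (.inc (.cls C) y)]]
  | _ => return []

/-- The list `[S]` if the test succeeds, the empty list otherwise. -/
def guardT (t : Timed Bool) (S : Tableau O F D) : Timed (List (Tableau O F D)) := do
  if ← t then return [S] else return []

/-- Conclusion of the rule for `[R_□]` with premises `b : C` and `y :: C'`. -/
def ruleBoxT (b : ObjName O D) (y : FeatName F D) (C' : LEConcept D) :
    LEConcept D → Timed (List (Tableau O F D))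
  | .box B => guardT (B.eqT C') [.pos (.rbox b y)]
  | _ => return []

/-- Conclusion of the rule for `⟨R_◇⟩` with premises `b : C` and `y :: C'`. -/
def ruleDiaT (b : ObjName O D) (y : FeatName F D) (C : LEConcept D) :
    LEConcept D → Timed (List (Tableau O F D))
  | .dia B => guardT (B.eqT C) [.pos (.rdia y b)]
  | _ => return []

/-- Conclusions of the rules with premises `b : C` and `y :: C'`. -/
def twoT (α β : TabAssertion O F D) : Timed (List (Tableau O F D)) := do
  tick
  match α, β with
  | .pos (.obj b C), .pos (.feat y C') =>
      appendT (← guardT (C.eqT C') [.pos (.inc b y)])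
        (← appendT (← ruleBoxT b y C' C) (← ruleDiaT b y C C'))
  | _, _ => return []

/-- Conclusions of the inverse rules for the concept `C`, with first premise `α`. -/
def introT (T : Tableau O F D) (C : LEConcept D) (α : TabAssertion O F D) :
    Timed (List (Tableau O F D)) := do
  tick
  match C, α with
  | .and C₁ C₂, .pos (.obj b B) =>
      guardT (do if ← C₁.eqT B then memT (.pos (.obj b C₂)) T else return false)
        [.pos (.obj b (.and C₁ C₂))]
  | .or C₁ C₂, .pos (.feat y B) =>
      guardT (do if ← C₁.eqT B then memT (.pos (.feat y C₂)) T else return false)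
        [.pos (.feat y (.or C₁ C₂))]
  | _, _ => return []

/-- The list of conclusions of all applicable rule instances. -/
def searchT (E : LocalInverse O F) (T : Tableau O F D) : Timed (List (Tableau O F D)) := do
  let l ← occursT T
  let r₁ ← flatMapT (fun C => do
    tick
    return [[.pos (.obj (.cls C) C), .pos (.feat (.cls C) C)]]) l
  let r₂ ← flatMapT (fun α => oneT E α) T
  let r₃ ← flatMapT (fun α => flatMapT (fun β => twoT α β) T) T
  let r₄ ← flatMapT (fun C => flatMapT (fun α => introT T C α) T) l
  filterT (newT T) (← appendT r₁ (← appendT r₂ (← appendT r₃ r₄)))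

/-- One round of the algorithm: test for a clash; if there is none, find the applicable rule
instances. -/
def roundT (E : LocalInverse O F) (T : Tableau O F D) : Timed (Option (List (Tableau O F D))) := do
  if ← clashT T then return none else return some (← searchT E T)

end Program

/-! ### The program computes what it should -/

section Correctness

variable {O F D : Type}

@[simp] theorem appendT_val {α : Type} (k l : List α) : (appendT k l).val = k ++ l := by
  induction k with
  | nil => rfl
  | cons a k ih => simp [appendT, ih]

@[simp] theorem mem_flatMapT {α β : Type} (f : α → Timed (List β)) (l : List α) (b : β) :
    b ∈ (flatMapT f l).val ↔ ∃ a ∈ l, b ∈ (f a).val := by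
  induction l with
  | nil => simp [flatMapT]
  | cons a l ih => simp [flatMapT, ih]

@[simp] theorem mem_filterT {α : Type} (f : α → Timed Bool) (l : List α) (a : α) :
    a ∈ (filterT f l).val ↔ a ∈ l ∧ (f a).val = true := by
  induction l with
  | nil => simp [filterT]
  | cons b l ih =>
    simp only [filterT, val_bind, val_ite, val_pure]
    split <;> simp [ih] <;> grind

@[simp] theorem anyT_iff {α : Type} (f : α → Timed Bool) (l : List α) :
    (anyT f l).val = true ↔ ∃ a ∈ l, (f a).val = true := by
  induction l with
  | nil => simp [anyT]
  | cons a l ih => simp [anyT, ih]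

@[simp] theorem LEConcept.mem_subT (C C' : LEConcept D) (l : List (LEConcept D)) :
    C' ∈ (C.subT l).val ↔ C.Sub C' ∨ C' ∈ l := by
  induction C generalizing l <;> simp [LEConcept.subT, LEConcept.Sub, *] <;> tauto

@[simp] theorem mem_occursT (T : Tableau O F D) (C : LEConcept D) :
    C ∈ (occursT T).val ↔ Occurs T C := by
  simp only [occursT, mem_flatMapT, Occurs]
  refine exists_congr fun α => and_congr_right fun _ => ?_
  cases α.concept? <;> simp

@[simp] theorem mem_guardT (t : Timed Bool) (S S' : Tableau O F D) :
    S' ∈ (guardT t S).val ↔ t.val = true ∧ S' = S := by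
  simp only [guardT, val_bind, val_ite, val_pure]
  split <;> simp_all

theorem mem_incFeat {E : LocalInverse O F} {T S : Tableau O F D} {b : ObjName O D}
    {y : FeatName F D} (hα : .pos (.inc b y) ∈ T) (h : S ∈ incFeat b y) : Rule E T S := by
  unfold incFeat at h
  split at h <;> simp at h
  · rcases h with rfl | rfl
    · exact .app_feat hα
    · exact .of_box (y := .cls _) hα
  · exact h ▸ .app_feat hα
  · rename_i y hy
    subst h
    refine .of_box ?_
    cases y <;> simp_all [FeatName.mkBox]
  · exact h ▸ .of_bbox hα

theorem mem_incObj {E : LocalInverse O F} {T S : Tableau O F D} {b : ObjName O D}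
    {y : FeatName F D} (hα : .pos (.inc b y) ∈ T) (h : S ∈ incObj y b) : Rule E T S := by
  unfold incObj at h
  split at h <;> simp at h
  · rcases h with rfl | rfl
    · exact .app_obj hα
    · exact .of_dia (b := .cls _) hα
  · exact h ▸ .app_obj hα
  · rename_i b hb
    subst h
    refine .of_dia ?_
    cases b <;> simp_all [ObjName.mkDia]
  · exact h ▸ .of_bdia hα

variable [DecidableEq O] [DecidableEq F] [DecidableEq D]

@[simp] theorem LEConcept.eqT_iff (C C' : LEConcept D) : (C.eqT C').val = true ↔ C = C' := by
  induction C generalizing C' <;> cases C' <;> simp [LEConcept.eqT, *]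

@[simp] theorem ObjName.eqT_iff (b b' : ObjName O D) : (b.eqT b').val = true ↔ b = b' := by
  induction b generalizing b' <;> cases b' <;> simp [ObjName.eqT, *]

@[simp] theorem FeatName.eqT_iff (y y' : FeatName F D) : (y.eqT y').val = true ↔ y = y' := by
  induction y generalizing y' <;> cases y' <;> simp [FeatName.eqT, *]

@[simp] theorem Term.eqT_iff (t t' : Term (ObjName O D) (FeatName F D) D) :
    (t.eqT t').val = true ↔ t = t' := by
  cases t <;> cases t' <;> simp [Term.eqT, and_comm]

@[simp] theorem Assertion.eqT_iff (α β : TabAssertion O F D) :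
    (α.eqT β).val = true ↔ α = β := by
  cases α <;> cases β <;> simp [Assertion.eqT]

@[simp] theorem memT_iff (α : TabAssertion O F D) (T : Tableau O F D) :
    (memT α T).val = true ↔ α ∈ T := by
  simp [memT]

@[simp] theorem newT_iff (T S : Tableau O F D) : (newT T S).val = true ↔ ¬ S ⊆ T := by
  simp [newT, List.subset_def, ← Bool.not_eq_true]

theorem clashT_iff (T : Tableau O F D) : (clashT T).val = true ↔ HasClash T := by
  simp only [clashT, anyT_iff, HasClash]
  constructor
  · rintro ⟨α, hα, h⟩
    rcases α with t | t <;> cases t <;> simp at h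
    all_goals exact ⟨_, by simp [Term.IsRelational], h, hα⟩
  · rintro ⟨β, hβ, h, h'⟩
    refine ⟨_, h', ?_⟩
    cases β <;> simp_all [Term.IsRelational]

theorem rule_of_mem_oneT {E : LocalInverse O F} {T S : Tableau O F D} {α : TabAssertion O F D}
    (hα : α ∈ T) (h : S ∈ (oneT E α).val) : Rule E T S := by
  simp only [oneT, val_bind] at h
  split at h <;> simp at h
  · exact h.elim (mem_incFeat hα) (mem_incObj hα)
  · rcases h with rfl | h
    · exact .adj_box hα
    · unfold ruleSA at h
      split at h <;> simp at h
      obtain ⟨rfl, rfl⟩ := h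
      exact .SA rfl hα
  · rcases h with rfl | h
    · exact .adj_dia hα
    · unfold ruleSX at h
      split at h <;> simp at h
      obtain ⟨rfl, rfl⟩ := h
      exact .SX rfl hα
  · exact h ▸ .and_elim hα
  · exact h ▸ .or_elim hα
  · exact h ▸ .neg_obj hα
  · exact h ▸ .neg_feat hα

theorem rule_of_mem_twoT {E : LocalInverse O F} {T S : Tableau O F D} {α β : TabAssertion O F D}
    (hα : α ∈ T) (hβ : β ∈ T) (h : S ∈ (twoT α β).val) : Rule E T S := by
  simp only [twoT, val_bind] at h
  split at h
  · simp at h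
    rcases h with ⟨rfl, rfl⟩ | h | h
    · exact .basic hα hβ
    · unfold ruleBoxT at h
      split at h <;> simp at h
      obtain ⟨rfl, rfl⟩ := h
      exact .box hα hβ
    · unfold ruleDiaT at h
      split at h <;> simp at h
      obtain ⟨rfl, rfl⟩ := h
      exact .dia hβ hα
  · simp at h

theorem rule_of_mem_introT {E : LocalInverse O F} {T S : Tableau O F D} {C : LEConcept D}
    {α : TabAssertion O F D} (hC : Occurs T C) (hα : α ∈ T) (h : S ∈ (introT T C α).val) :
    Rule E T S := by
  simp only [introT, val_bind] at h
  split at h <;> simp at h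
  · obtain ⟨⟨rfl, h⟩, rfl⟩ := h
    exact .and_intro hα h hC
  · obtain ⟨⟨rfl, h⟩, rfl⟩ := h
    exact .or_intro hα h hC

/-- The search finds exactly the conclusions of the applicable rule instances. -/
theorem mem_searchT (E : LocalInverse O F) (T S : Tableau O F D) :
    S ∈ (searchT E T).val ↔ Applicable E T S := by
  have key : S ∈ (searchT E T).val ↔ ((∃ C, Occurs T C ∧
      S = [.pos (.obj (.cls C) C), .pos (.feat (.cls C) C)]) ∨ (∃ α ∈ T, S ∈ (oneT E α).val) ∨
      (∃ α ∈ T, ∃ β ∈ T, S ∈ (twoT α β).val) ∨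
      (∃ C, Occurs T C ∧ ∃ α ∈ T, S ∈ (introT T C α).val)) ∧ ¬ S ⊆ T := by
    simp [searchT]
  rw [key, Applicable]
  refine and_congr_left fun _ => ⟨?_, ?_⟩
  · rintro (⟨C, hC, rfl⟩ | ⟨α, hα, h⟩ | ⟨α, hα, β, hβ, h⟩ | ⟨C, hC, α, hα, h⟩)
    · exact .create hC
    · exact rule_of_mem_oneT hα h
    · exact rule_of_mem_twoT hα hβ h
    · exact rule_of_mem_introT hC hα h
  · intro h
    cases h with
    | create hC => exact .inl ⟨_, hC, rfl⟩
    | basic h h' => exact .inr (.inr (.inl ⟨_, h, _, h', by simp [twoT, ruleBoxT]⟩))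
    | box h h' => exact .inr (.inr (.inl ⟨_, h, _, h', by simp [twoT, ruleBoxT]⟩))
    | dia h h' => exact .inr (.inr (.inl ⟨_, h', _, h, by simp [twoT, ruleDiaT]⟩))
    | and_intro h h' hC =>
      exact .inr (.inr (.inr ⟨_, hC, _, h, by simp [introT, h']⟩))
    | or_intro h h' hC =>
      exact .inr (.inr (.inr ⟨_, hC, _, h, by simp [introT, h']⟩))
    | and_elim h => exact .inr (.inl ⟨_, h, by simp [oneT]⟩)
    | or_elim h => exact .inr (.inl ⟨_, h, by simp [oneT]⟩)
    | @of_box b y h =>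
      exact .inr (.inl ⟨_, h, by cases y <;> simp [oneT, FeatName.mkBox, incFeat]⟩)
    | of_bbox h => exact .inr (.inl ⟨_, h, by simp [oneT, incFeat]⟩)
    | @of_dia b y h =>
      exact .inr (.inl ⟨_, h, by cases b <;> simp [oneT, ObjName.mkDia, incObj]⟩)
    | of_bdia h => exact .inr (.inl ⟨_, h, by simp [oneT, incObj]⟩)
    | adj_box h => exact .inr (.inl ⟨_, h, by simp [oneT]⟩)
    | adj_dia h => exact .inr (.inl ⟨_, h, by simp [oneT]⟩)
    | neg_obj h => exact .inr (.inl ⟨_, h, by simp [oneT]⟩)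
    | neg_feat h => exact .inr (.inl ⟨_, h, by simp [oneT]⟩)
    | @app_feat b C h => exact .inr (.inl ⟨_, h, by cases C <;> simp [oneT, incFeat]⟩)
    | @app_obj y C h => exact .inr (.inl ⟨_, h, by cases C <;> simp [oneT, incObj]⟩)
    | SA hE h => exact .inr (.inl ⟨_, h, by simp [oneT, hE, ruleSA]⟩)
    | SX hE h => exact .inr (.inl ⟨_, h, by simp [oneT, hE, ruleSX]⟩)

/-- A round finds a clash if there is one. -/
theorem roundT_eq_none (E : LocalInverse O F) (T : Tableau O F D) :
    (roundT E T).val = none ↔ HasClash T := by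
  rw [← clashT_iff, roundT]
  simp

/-- If there is no clash, a round finds the applicable rule instances. -/
theorem roundT_eq_some (E : LocalInverse O F) (T : Tableau O F D) (h : ¬ HasClash T) :
    ∃ L, (roundT E T).val = some L ∧ ∀ S, S ∈ L ↔ Applicable E T S := by
  rw [← clashT_iff] at h
  exact ⟨(searchT E T).val, by simp [roundT, h], mem_searchT E T⟩

end Correctness

/-! ## Runs of the algorithm -/

section Runs

variable {O F D : Type} [DecidableEq O] [DecidableEq F] [DecidableEq D]

/-- `Run E T₀ T n`: starting from `T₀`, after finitely many rounds, in each of which there is no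
clash and an arbitrarily chosen applicable rule instance is applied, the tableau is `T`, and `n`
elementary steps have been spent. -/
inductive Run (E : LocalInverse O F) (T₀ : Tableau O F D) : Tableau O F D → ℕ → Prop
  | start : Run E T₀ T₀ 0
  | step {T n S} : Run E T₀ T n → ¬ HasClash T → Applicable E T S →
      Run E T₀ (S ++ T) (n + (roundT E T).cost + S.length)

/-- The answers of the algorithm. -/
inductive Answer : Type
  | consistent
  | inconsistent

/-- The algorithm halts on the tableau `T` with the given answer: `inconsistent` if there is a
clash, and `consistent` if there is none and no rule is applicable. -/
inductive Halts (E : LocalInverse O F) (T : Tableau O F D) : Answer → Prop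
  | clash : HasClash T → Halts E T .inconsistent
  | complete : ¬ HasClash T → (∀ S, ¬ Applicable E T S) → Halts E T .consistent

end Runs

end LEALC

open LEALC

namespace LEALC

/-! ## Soundness in modal lattices -/

/-! The rules are sound far beyond concept lattices. Take any lattice with adjunctions ◆ ⊣ □ and ◇ ⊣
■, read names as elements, both a_C and x_C as C, incidence and membership as ≤, `b R_□ y` as b ≤ □y
and `y R_◇ b` as ◇b ≤ y. Every rule then becomes a lattice fact, so truth passes along it
(`Valuation.HoldsPos.rule`, `Valuation.HoldsNeg.rule`) once the axiom holds for all lattice elements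
p. This one argument is used for two purposes.

Correctness. In the concept lattice of a model it shows that a consistent ABox never runs into a
clash. Conversely, a saturated clash-free tableau is its own model: the elements are the names,
compatibility holds because every required set is the polar of a single name, and the truth lemma
`Saturated.mem_eval` uses a_C and x_C as witnesses for C.

Termination. The rules stack operators on names and, through □x_C = x_{□C} and ◇a_C = a_{◇C}, create
concepts outside the ABox. The remedy is to choose valuations in which the positive terms of every
ABox and both axioms are true. Everything positive that is derived is then true there as well, and
each valuation excludes one kind of growth: (1) two lattices of sets of modal words, one for □ and
one for ◇, force each new concept to be an old concept under a prefix that already is a modal path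
of the ABox (`ABox.Admits.exists_prefixed`), which leaves at most n^3 concepts; (2) translations of
the integers bound the number of operators on a name linearly in n; (3) a six-element chain
restricts their order to a fixed pattern with two free exponents (`ObjName.exists_build_of_chain`),
so bounded depth leaves polynomially many names instead of exponentially many. Negative assertions
never acquire operators on names and are bounded directly.

Hence a tableau has polynomially many distinct assertions, all of linear size. Each applied rule
instance adds a new one, and a round costs polynomially many steps in the length of the tableau, so
total cost and termination follow. -/

/-- Lattices with modal operators `□`, `◇` and their adjoints `◆ ⊣ □` and `◇ ⊣ ■`. -/
structure ModalLattice (L : Type*) [Lattice L] where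
  box : L → L
  bdia : L → L
  dia : L → L
  bbox : L → L
  gc_box : GaloisConnection bdia box
  gc_dia : GaloisConnection dia bbox

/-- The order dual of a modal lattice, which exchanges the two adjunctions. -/
def ModalLattice.dual {L : Type*} [Lattice L] (m : ModalLattice L) : ModalLattice Lᵒᵈ where
  box a := .toDual (m.dia a.ofDual)
  bdia a := .toDual (m.bbox a.ofDual)
  dia a := .toDual (m.box a.ofDual)
  bbox a := .toDual (m.bdia a.ofDual)
  gc_box := m.gc_dia.dual
  gc_dia := m.gc_box.dual

/-- A modal lattice with values for the atoms and the names. -/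
structure Valuation (O F D : Type) (L : Type*) [Lattice L] extends ModalLattice L where
  atom : D → L
  obj : O → L
  feat : F → L

namespace Valuation

variable {O F D : Type} {L : Type*} [Lattice L] (v : Valuation O F D L)

/-- The value of a concept. -/
def concept : LEConcept D → L
  | .atom d => v.atom d
  | .and C₁ C₂ => concept C₁ ⊓ concept C₂
  | .or C₁ C₂ => concept C₁ ⊔ concept C₂
  | .box C => v.box (concept C)
  | .dia C => v.dia (concept C)

/-- The value of an object name. -/
def objName : ObjName O D → L
  | .base b => v.obj b
  | .cls C => v.concept C
  | .bdia b => v.bdia (objName b)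
  | .dia b => v.dia (objName b)

/-- The value of a feature name. -/
def featName : FeatName F D → L
  | .base y => v.feat y
  | .cls C => v.concept C
  | .box y => v.box (featName y)
  | .bbox y => v.bbox (featName y)

@[simp] theorem objName_mkDia (b : ObjName O D) : v.objName b.mkDia = v.dia (v.objName b) := by
  cases b <;> rfl

@[simp] theorem featName_mkBox (y : FeatName F D) :
    v.featName y.mkBox = v.box (v.featName y) := by
  cases y <;> rfl

/-- The truth of a term over the tableaux names. -/
def Holds : Term (ObjName O D) (FeatName F D) D → Prop
  | .inc b y => v.objName b ≤ v.featName y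
  | .rbox b y => v.objName b ≤ v.box (v.featName y)
  | .rdia y b => v.dia (v.objName b) ≤ v.featName y
  | .obj b C => v.objName b ≤ v.concept C
  | .feat y C => v.concept C ≤ v.featName y

/-- The truth of the additional axiom. -/
def HoldsAxiom : LocalInverse O F → Prop
  | .SA b => ∀ p, v.obj b ≤ v.box p → v.dia (v.obj b) ≤ p
  | .SX y => ∀ p, v.dia p ≤ v.feat y → p ≤ v.box (v.feat y)

/-- The truth of the positive assertions of a tableau. -/
def HoldsPos (T : Tableau O F D) : Prop :=
  ∀ t, Assertion.pos t ∈ T → v.Holds t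

/-- The truth of the negative assertions of a tableau. -/
def HoldsNeg (T : Tableau O F D) : Prop :=
  ∀ t, Assertion.neg t ∈ T → ¬ v.Holds t

variable {v}

theorem HoldsPos.append {S T : Tableau O F D} (hS : v.HoldsPos S) (hT : v.HoldsPos T) :
    v.HoldsPos (S ++ T) :=
  fun t ht => (List.mem_append.1 ht).elim (hS t) (hT t)

theorem HoldsNeg.append {S T : Tableau O F D} (hS : v.HoldsNeg S) (hT : v.HoldsNeg T) :
    v.HoldsNeg (S ++ T) :=
  fun t ht => (List.mem_append.1 ht).elim (hS t) (hT t)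

/-- The basic rule is transitivity, the modal rules add monotonicity of □ and ◇, and compatibility
and adjunction rules are the two Galois connections. Creation and appending are immediate since a_C
and x_C take the value of C. The axiom enters only in the last two cases. -/
theorem HoldsPos.rule {E : LocalInverse O F} {T S : Tableau O F D} (hE : v.HoldsAxiom E)
    (h : v.HoldsPos T) (r : Rule E T S) : v.HoldsPos S := by
  intro t ht
  cases r with
  | create hC =>
    simp only [List.mem_cons, Assertion.pos.injEq, List.not_mem_nil, or_false] at ht
    rcases ht with rfl | rfl <;> simp [Holds, objName, featName]
  | basic h₁ h₂ =>
    obtain rfl : t = _ := by simpa using ht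
    exact (h _ h₁).trans (h _ h₂)
  | and_elim h₁ =>
    simp only [List.mem_cons, Assertion.pos.injEq, List.not_mem_nil, or_false] at ht
    have := le_inf_iff.1 (h _ h₁)
    rcases ht with rfl | rfl
    exacts [this.1, this.2]
  | or_elim h₁ =>
    simp only [List.mem_cons, Assertion.pos.injEq, List.not_mem_nil, or_false] at ht
    have := sup_le_iff.1 (h _ h₁)
    rcases ht with rfl | rfl
    exacts [this.1, this.2]
  | box h₁ h₂ =>
    obtain rfl : t = _ := by simpa using ht
    exact (h _ h₁).trans (v.gc_box.monotone_u (h _ h₂))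
  | dia h₁ h₂ =>
    obtain rfl : t = _ := by simpa using ht
    exact (v.gc_dia.monotone_l (h _ h₂)).trans (h _ h₁)
  | of_box h₁ =>
    obtain rfl : t = _ := by simpa using ht
    simpa [Holds] using h _ h₁
  | of_bbox h₁ =>
    obtain rfl : t = _ := by simpa using ht
    exact (v.gc_dia _ _).2 (h _ h₁)
  | of_dia h₁ =>
    obtain rfl : t = _ := by simpa using ht
    simpa [Holds] using h _ h₁
  | of_bdia h₁ =>
    obtain rfl : t = _ := by simpa using ht
    exact (v.gc_box _ _).1 (h _ h₁)
  | and_intro h₁ h₂ _ =>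
    obtain rfl : t = _ := by simpa using ht
    exact le_inf (h _ h₁) (h _ h₂)
  | or_intro h₁ h₂ _ =>
    obtain rfl : t = _ := by simpa using ht
    exact sup_le (h _ h₁) (h _ h₂)
  | adj_box h₁ =>
    simp only [List.mem_cons, Assertion.pos.injEq, List.not_mem_nil, or_false] at ht
    rcases ht with rfl | rfl
    · exact (v.gc_box _ _).2 (h _ h₁)
    · simpa [Holds] using h _ h₁
  | adj_dia h₁ =>
    simp only [List.mem_cons, Assertion.pos.injEq, List.not_mem_nil, or_false] at ht
    rcases ht with rfl | rfl
    · simpa [Holds] using h _ h₁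
    · exact (v.gc_dia _ _).1 (h _ h₁)
  | neg_obj _ => simp at ht
  | neg_feat _ => simp at ht
  | app_feat h₁ =>
    obtain rfl : t = _ := by simpa using ht
    exact h (.inc _ _) h₁
  | app_obj h₁ =>
    obtain rfl : t = _ := by simpa using ht
    exact h (.inc _ _) h₁
  | SA hE' h₁ =>
    subst hE'
    obtain rfl : t = _ := by simpa using ht
    exact hE _ (h _ h₁)
  | SX hE' h₁ =>
    subst hE'
    obtain rfl : t = _ := by simpa using ht
    exact hE _ (h _ h₁)

/-- Only two rules produce negative assertions, and both replace C by a name of the same value, so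
the axiom plays no role. -/
theorem HoldsNeg.rule {E : LocalInverse O F} {T S : Tableau O F D}
    (h : v.HoldsNeg T) (r : Rule E T S) : v.HoldsNeg S := by
  intro t ht
  cases r with
  | neg_obj h₁ =>
    obtain rfl : t = _ := by simpa using ht
    exact h (.obj _ _) h₁
  | neg_feat h₁ =>
    obtain rfl : t = _ := by simpa using ht
    exact h (.feat _ _) h₁
  | _ => simp at ht

end Valuation

/-! ## Soundness -/

namespace EnrichedContext

variable (P : EnrichedContext)

/-- The concept lattice of an enriched formal context as a modal lattice. -/
def modalLattice : ModalLattice (Concept P.A P.X P.I) where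
  box := P.boxOp
  dia := P.diaOp
  bdia c := Concept.ofIsIntent P.I (upperPolar P.Rbox c.extent) (by
    have h : upperPolar P.Rbox c.extent = ⋂ a ∈ c.extent, {x | P.Rbox a x} := by
      ext a; simp [mem_upperPolar_iff]
    rw [h]
    exact Order.IsIntent.iInter₂ _ fun a _ => P.rbox_intent a)
  bbox c := Concept.ofIsExtent P.I (upperPolar P.Rdia c.intent) (by
    have h : upperPolar P.Rdia c.intent = ⋂ x ∈ c.intent, {a | P.Rdia x a} := by
      ext a; simp [mem_upperPolar_iff]
    rw [h]
    exact Order.IsExtent.iInter₂ _ fun x _ => P.rdia_extent x)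
  gc_box c d := by
    rw [← Concept.intent_subset_intent_iff, ← Concept.extent_subset_extent_iff]
    exact subset_upperPolar_iff_subset_lowerPolar
  gc_dia c d := by
    rw [← Concept.intent_subset_intent_iff, ← Concept.extent_subset_extent_iff]
    exact subset_upperPolar_iff_subset_lowerPolar.symm

end EnrichedContext

/-! ### Truth in an interpretation as truth in its concept lattice -/

namespace Interpretation

variable {O F D : Type} (M : Interpretation O F D)

/-- The valuation in the concept lattice given by an interpretation. -/
def valuation : Valuation O F D (Concept M.ctx.A M.ctx.X M.ctx.I) where
  toModalLattice := M.ctx.modalLattice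
  atom := M.atom
  obj b := .ofObject M.ctx.I (M.obj b)
  feat y := .ofAttribute M.ctx.I (M.feat y)

theorem valuation_concept (C : LEConcept D) : M.valuation.concept C = M.eval C := by
  induction C with
  | atom d => rfl
  | and C₁ C₂ h₁ h₂ => simp [Valuation.concept, eval, h₁, h₂]
  | or C₁ C₂ h₁ h₂ => simp [Valuation.concept, eval, h₁, h₂]
  | box C h => simp [Valuation.concept, eval, h]; rfl
  | dia C h => simp [Valuation.concept, eval, h]; rfl

theorem ofObject_le_boxOp (a : M.ctx.A) (c : Concept M.ctx.A M.ctx.X M.ctx.I) :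
    .ofObject M.ctx.I a ≤ M.ctx.boxOp c ↔ ∀ x ∈ c.intent, M.ctx.Rbox a x := by
  simp [EnrichedContext.boxOp, mem_lowerPolar_iff]

theorem diaOp_le_ofAttribute (x : M.ctx.X) (c : Concept M.ctx.A M.ctx.X M.ctx.I) :
    M.ctx.diaOp c ≤ .ofAttribute M.ctx.I x ↔ ∀ a ∈ c.extent, M.ctx.Rdia x a := by
  simp [EnrichedContext.diaOp, mem_lowerPolar_iff]

/-- This is where compatibility is needed. By adjunction the claim concerns ◆ of the concept
generated by a, whose intent is a polar of the closure of {a}; the set of all a' with a' R_□ x is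
Galois-stable, so it contains that closure as soon as it contains a. -/
theorem ofObject_le_boxOp_ofAttribute (a : M.ctx.A) (x : M.ctx.X) :
    .ofObject M.ctx.I a ≤ M.ctx.boxOp (.ofAttribute M.ctx.I x) ↔ M.ctx.Rbox a x := by
  refine (M.ctx.modalLattice.gc_box _ _).symm.trans ?_
  rw [Concept.le_ofAttributes_iff, Set.singleton_subset_iff]
  change _ ∈ upperPolar _ (lowerPolar _ (upperPolar _ _)) ↔ _
  rw [mem_upperPolar_iff]
  refine ⟨fun h => h (subset_lowerPolar_upperPolar _ _ rfl), fun h a' ha' => ?_⟩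
  exact (M.ctx.rbox_extent x).lowerPolar_upperPolar_subset (s' := {a}) (by simpa using h) ha'

theorem diaOp_ofObject_le_ofAttribute (a : M.ctx.A) (x : M.ctx.X) :
    M.ctx.diaOp (.ofObject M.ctx.I a) ≤ .ofAttribute M.ctx.I x ↔ M.ctx.Rdia x a := by
  rw [diaOp_le_ofAttribute]
  refine ⟨fun h => h _ (subset_lowerPolar_upperPolar _ _ rfl), fun h a' ha' => ?_⟩
  exact (M.ctx.rdia_extent x).lowerPolar_upperPolar_subset (s' := {a}) (by simpa using h) ha'

theorem valuation_holds (t : Term O F D) :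
    M.valuation.Holds (t.map .base .base) ↔ M.SatTerm t := by
  cases t with
  | inc b y => exact Concept.ofObject_le_ofAttribute_iff
  | rbox b y => exact M.ofObject_le_boxOp_ofAttribute _ _
  | rdia y b => exact M.diaOp_ofObject_le_ofAttribute _ _
  | obj b C =>
    simp only [Valuation.Holds, Term.map, valuation_concept]
    exact Concept.ofObjects_le_iff.trans Set.singleton_subset_iff
  | feat y C =>
    simp only [Valuation.Holds, Term.map, valuation_concept]
    exact Concept.le_ofAttributes_iff.trans Set.singleton_subset_iff

/-- The axiom speaks of single elements p, the lattice version of concepts p. Comparing intents (for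
`SA`) or extents (for `SX`) reduces the latter to one element at a time. -/
theorem valuation_holdsAxiom {E : LocalInverse O F} (h : M.SatAxiom E) :
    M.valuation.HoldsAxiom E := by
  cases E with
  | SA b =>
    intro p hp
    have hp := (M.ofObject_le_boxOp _ _).1 hp
    rw [← Concept.intent_subset_intent_iff]
    intro x hx
    exact Set.singleton_subset_iff.1 (Concept.le_ofAttributes_iff.1
      ((M.diaOp_ofObject_le_ofAttribute _ x).2 (h x (hp x hx))))
  | SX y =>
    intro p hp
    have hp := (M.diaOp_le_ofAttribute _ _).1 hp
    intro a ha
    exact Set.singleton_subset_iff.1 (Concept.ofObjects_le_iff.1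
      ((M.ofObject_le_boxOp_ofAttribute a _).2 (h a (hp a ha))))

end Interpretation

section

variable {O F D : Type} [DecidableEq O] [DecidableEq F] [DecidableEq D]

theorem Run.holdsPos {L : Type*} [Lattice L] {v : Valuation O F D L} {E : LocalInverse O F}
    {T₀ T : Tableau O F D} {n : ℕ} (hE : v.HoldsAxiom E) (h₀ : v.HoldsPos T₀)
    (r : Run E T₀ T n) : v.HoldsPos T := by
  induction r with
  | start => exact h₀
  | step _ _ hS ih => exact (ih.rule hE hS.1).append ih

theorem Run.holdsNeg {L : Type*} [Lattice L] {v : Valuation O F D L} {E : LocalInverse O F}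
    {T₀ T : Tableau O F D} {n : ℕ} (h₀ : v.HoldsNeg T₀)
    (r : Run E T₀ T n) : v.HoldsNeg T := by
  induction r with
  | start => exact h₀
  | step _ _ hS ih => exact (ih.rule hS.1).append ih

theorem Run.not_hasClash_of_consistent {E : LocalInverse O F} {A : ABox O F D}
    {T : Tableau O F D} {n : ℕ} (hA : Consistent E A) (r : Run E A.toTab T n) :
    ¬ HasClash T := by
  obtain ⟨M, hM, hE⟩ := hA
  rintro ⟨β, -, hp, hn⟩
  refine r.holdsNeg (v := M.valuation) ?_ β hn
    (r.holdsPos (M.valuation_holdsAxiom hE) ?_ β hp)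
  · intro t ht
    obtain ⟨α, hα, h⟩ := List.mem_map.1 ht
    cases α with
    | pos t => simp [Assertion.toTab] at h
    | neg t =>
      obtain rfl := Assertion.neg.inj h
      rw [M.valuation_holds]
      exact hM _ hα
  · intro t ht
    obtain ⟨α, hα, h⟩ := List.mem_map.1 ht
    cases α with
    | neg t => simp [Assertion.toTab] at h
    | pos t =>
      obtain rfl := Assertion.pos.inj h
      rw [M.valuation_holds]
      exact hM _ hα

end

/-! ## Completeness -/

theorem LEConcept.Sub.refl {D : Type} (C : LEConcept D) : C.Sub C := by
  cases C <;> simp [LEConcept.Sub]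

theorem LEConcept.Sub.trans {D : Type} {C C' C'' : LEConcept D} (h : C.Sub C') (h' : C'.Sub C'') :
    C.Sub C'' := by
  induction C with
  | atom d => obtain rfl : C' = _ := h; exact h'
  | and C₁ C₂ h₁ h₂ =>
    rcases h with rfl | h | h
    exacts [h', .inr (.inl (h₁ h)), .inr (.inr (h₂ h))]
  | or C₁ C₂ h₁ h₂ =>
    rcases h with rfl | h | h
    exacts [h', .inr (.inl (h₁ h)), .inr (.inr (h₂ h))]
  | box C ih =>
    rcases h with rfl | h
    exacts [h', .inr (ih h)]
  | dia C ih =>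
    rcases h with rfl | h
    exacts [h', .inr (ih h)]

section

variable {O F D : Type}

theorem Occurs.sub {T : Tableau O F D} {C C' : LEConcept D} (h : Occurs T C) (h' : C.Sub C') :
    Occurs T C' := by
  obtain ⟨α, hα, B, hB, hs⟩ := h
  exact ⟨α, hα, B, hB, hs.trans h'⟩

/-- A tableau to which no rule adds a new assertion. -/
def Saturated (E : LocalInverse O F) (T : Tableau O F D) : Prop :=
  ∀ S, Rule E T S → S ⊆ T

variable {E : LocalInverse O F} {T : Tableau O F D}

theorem Saturated.rbox_iff_mkBox (hT : Saturated E T) {b : ObjName O D} {y : FeatName F D} :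
    .pos (.rbox b y) ∈ T ↔ .pos (.inc b y.mkBox) ∈ T :=
  ⟨fun h => hT _ (.adj_box h) (by simp), fun h => hT _ (.of_box h) (by simp)⟩

theorem Saturated.rbox_iff_bdia (hT : Saturated E T) {b : ObjName O D} {y : FeatName F D} :
    .pos (.rbox b y) ∈ T ↔ .pos (.inc b.bdia y) ∈ T :=
  ⟨fun h => hT _ (.adj_box h) (by simp), fun h => hT _ (.of_bdia h) (by simp)⟩

theorem Saturated.rdia_iff_mkDia (hT : Saturated E T) {b : ObjName O D} {y : FeatName F D} :
    .pos (.rdia y b) ∈ T ↔ .pos (.inc b.mkDia y) ∈ T :=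
  ⟨fun h => hT _ (.adj_dia h) (by simp), fun h => hT _ (.of_dia h) (by simp)⟩

theorem Saturated.rdia_iff_bbox (hT : Saturated E T) {b : ObjName O D} {y : FeatName F D} :
    .pos (.rdia y b) ∈ T ↔ .pos (.inc b y.bbox) ∈ T :=
  ⟨fun h => hT _ (.adj_dia h) (by simp), fun h => hT _ (.of_bbox h) (by simp)⟩

theorem Saturated.cls_mem (hT : Saturated E T) {C : LEConcept D} (hC : Occurs T C) :
    .pos (.obj (.cls C) C) ∈ T ∧ .pos (.feat (.cls C) C) ∈ T :=
  ⟨hT _ (.create hC) (by simp), hT _ (.create hC) (by simp)⟩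

theorem Saturated.inc_mem (hT : Saturated E T) {b : ObjName O D} {y : FeatName F D}
    {C : LEConcept D} (h : .pos (.obj b C) ∈ T) (h' : .pos (.feat y C) ∈ T) :
    .pos (.inc b y) ∈ T :=
  hT _ (.basic h h') (by simp)

theorem Saturated.obj_iff (hT : Saturated E T) {C : LEConcept D} (hC : Occurs T C)
    {b : ObjName O D} : .pos (.obj b C) ∈ T ↔ .pos (.inc b (.cls C)) ∈ T :=
  ⟨fun h => hT.inc_mem h (hT.cls_mem hC).2, fun h => hT _ (.app_feat h) (by simp)⟩

theorem Saturated.feat_iff (hT : Saturated E T) {C : LEConcept D} (hC : Occurs T C)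
    {y : FeatName F D} : .pos (.feat y C) ∈ T ↔ .pos (.inc (.cls C) y) ∈ T :=
  ⟨fun h => hT.inc_mem (hT.cls_mem hC).1 h, fun h => hT _ (.app_obj h) (by simp)⟩

/-- The canonical model of a saturated tableau: its elements are the tableaux names. -/
def Saturated.model (hT : Saturated E T) : Interpretation O F D where
  ctx :=
    { A := ObjName O D
      X := FeatName F D
      I := fun b y => .pos (.inc b y) ∈ T
      Rbox := fun b y => .pos (.rbox b y) ∈ T
      Rdia := fun y b => .pos (.rdia y b) ∈ T
      -- Saturation under the compatibility and adjunction rules makes each of the four sets the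
      -- polar of the single name □y, ◆b, ◇b or ■y.
      rbox_extent := fun y => ⟨{y.mkBox}, by ext b; simp [hT.rbox_iff_mkBox]⟩
      rbox_intent := fun b => ⟨{b.bdia}, by ext b; simp [hT.rbox_iff_bdia]⟩
      rdia_intent := fun b => ⟨{b.mkDia}, by ext b; simp [hT.rdia_iff_mkDia]⟩
      rdia_extent := fun y => ⟨{y.bbox}, by ext b; simp [hT.rdia_iff_bbox]⟩ }
  obj := .base
  feat := .base
  atom d := .ofAttribute _ (.cls (.atom d))

/-- For an occurring C the name a_C lies in the extent, so every feature in the intent is incident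
to a_C, and the appending rule yields y :: C. Thus half of the truth lemma gives the other half. -/
theorem Saturated.mem_intent_of_extent (hT : Saturated E T) {C : LEConcept D} (hC : Occurs T C)
    (h : ∀ b : ObjName O D, b ∈ (hT.model.eval C).extent ↔ .pos (.obj b C) ∈ T)
    (y : FeatName F D) : y ∈ (hT.model.eval C).intent ↔ .pos (.feat y C) ∈ T := by
  rw [← Concept.upperPolar_extent]
  refine ⟨fun hy => ?_, fun hy b hb => hT.inc_mem ((h b).1 hb) hy⟩
  exact (hT.feat_iff hC).2 (hy ((h _).2 (hT.cls_mem hC).1))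

theorem Saturated.mem_extent_of_intent (hT : Saturated E T) {C : LEConcept D} (hC : Occurs T C)
    (h : ∀ y : FeatName F D, y ∈ (hT.model.eval C).intent ↔ .pos (.feat y C) ∈ T)
    (b : ObjName O D) : b ∈ (hT.model.eval C).extent ↔ .pos (.obj b C) ∈ T := by
  rw [← Concept.lowerPolar_intent]
  refine ⟨fun hb => ?_, fun hb y hy => hT.inc_mem hb ((h y).1 hy)⟩
  exact (hT.obj_iff hC).2 (hb ((h _).2 (hT.cls_mem hC).2))

/-- Each connective is treated on its natural side: extents for atoms, meets and □, intents for
joins and ◇. Occurrence of C is needed for creation and for the inverse rules. -/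
theorem Saturated.mem_eval (hT : Saturated E T) {C : LEConcept D} (hC : Occurs T C) :
    (∀ b : ObjName O D, b ∈ (hT.model.eval C).extent ↔ .pos (.obj b C) ∈ T) ∧
      (∀ y : FeatName F D, y ∈ (hT.model.eval C).intent ↔ .pos (.feat y C) ∈ T) := by
  induction C with
  | atom d =>
    have h (b : ObjName O D) :
        b ∈ (hT.model.eval (.atom d)).extent ↔ .pos (.obj b (.atom d)) ∈ T := by
      rw [hT.obj_iff hC]
      change b ∈ lowerPolar _ _ ↔ _
      exact mem_lowerPolar_singleton _
    exact ⟨h, hT.mem_intent_of_extent hC h⟩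
  | and C₁ C₂ h₁ h₂ =>
    have h₁ := h₁ (hC.sub (.inr (.inl (.refl _))))
    have h₂ := h₂ (hC.sub (.inr (.inr (.refl _))))
    have h (b : ObjName O D) :
        b ∈ (hT.model.eval (.and C₁ C₂)).extent ↔ .pos (.obj b (.and C₁ C₂)) ∈ T := by
      refine (and_congr (h₁.1 b) (h₂.1 b)).trans ⟨fun h => hT _ (.and_intro h.1 h.2 hC) (by simp),
        fun h => ⟨hT _ (.and_elim h) (by simp), hT _ (.and_elim h) (by simp)⟩⟩
    exact ⟨h, hT.mem_intent_of_extent hC h⟩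
  | or C₁ C₂ h₁ h₂ =>
    have h₁ := h₁ (hC.sub (.inr (.inl (.refl _))))
    have h₂ := h₂ (hC.sub (.inr (.inr (.refl _))))
    have h (y : FeatName F D) :
        y ∈ (hT.model.eval (.or C₁ C₂)).intent ↔ .pos (.feat y (.or C₁ C₂)) ∈ T := by
      refine (and_congr (h₁.2 y) (h₂.2 y)).trans ⟨fun h => hT _ (.or_intro h.1 h.2 hC) (by simp),
        fun h => ⟨hT _ (.or_elim h) (by simp), hT _ (.or_elim h) (by simp)⟩⟩
    exact ⟨hT.mem_extent_of_intent hC h, h⟩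
  | box C ih =>
    have hC' := hC.sub (C' := C) (.inr (.refl _))
    have ih := ih hC'
    have h (b : ObjName O D) :
        b ∈ (hT.model.eval (.box C)).extent ↔ .pos (.obj b (.box C)) ∈ T := by
      change b ∈ lowerPolar _ _ ↔ _
      refine ⟨fun h => ?_, fun h y hy => hT _ (.box h ((ih.2 y).1 hy)) (by simp)⟩
      rw [hT.obj_iff hC]
      -- Membership in the extent of □C is tested at the feature x_C alone; the identification □x_C
      -- = x_{□C} turns the result into incidence with x_{□C}.
      exact hT.rbox_iff_mkBox.1 (h ((ih.2 _).2 (hT.cls_mem hC').2))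
    exact ⟨h, hT.mem_intent_of_extent hC h⟩
  | dia C ih =>
    have hC' := hC.sub (C' := C) (.inr (.refl _))
    have ih := ih hC'
    have h (y : FeatName F D) :
        y ∈ (hT.model.eval (.dia C)).intent ↔ .pos (.feat y (.dia C)) ∈ T := by
      change y ∈ lowerPolar _ _ ↔ _
      refine ⟨fun h => ?_, fun h b hb => hT _ (.dia h ((ih.1 b).1 hb)) (by simp)⟩
      rw [hT.feat_iff hC]
      exact hT.rdia_iff_mkDia.1 (h ((ih.1 _).2 (hT.cls_mem hC').1))
    exact ⟨hT.mem_extent_of_intent hC h, h⟩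

/-- The elements of the canonical model are exactly the names over which the additional rule ranges.
-/
theorem Saturated.model_satAxiom (hT : Saturated E T) : hT.model.SatAxiom E := by
  cases E with
  | SA b => exact fun p hp => hT _ (.SA rfl hp) (List.mem_singleton_self _)
  | SX y => exact fun p hp => hT _ (.SX rfl hp) (List.mem_singleton_self _)

/-- Clashes involve relational terms only. A negated membership that failed in the model would give
both b I x_C and its negation (or the analogue with a_C), by the truth lemma and the rules for
negative assertions. -/
theorem Saturated.consistent (hT : Saturated E T) (hc : ¬ HasClash T) {A : ABox O F D}
    (hA : A.toTab ⊆ T) : Consistent E A := by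
  refine ⟨hT.model, fun α hα => ?_, hT.model_satAxiom⟩
  have hα : α.toTab ∈ T := hA (List.mem_map_of_mem hα)
  have hocc {C} (h : α.toTab.concept? = some C) : Occurs T C := ⟨_, hα, C, h, .refl C⟩
  rcases α with t | t
  · cases t with
    | inc b y => exact hα
    | rbox b y => exact hα
    | rdia y b => exact hα
    | obj b C => exact ((hT.mem_eval (hocc rfl)).1 _).2 hα
    | feat y C => exact ((hT.mem_eval (hocc rfl)).2 _).2 hα
  · cases t with
    | inc b y => exact fun h => hc ⟨.inc _ _, trivial, h, hα⟩
    | rbox b y => exact fun h => hc ⟨.rbox _ _, trivial, h, hα⟩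
    | rdia y b => exact fun h => hc ⟨.rdia _ _, trivial, h, hα⟩
    | obj b C =>
      intro h
      have h := ((hT.mem_eval (hocc rfl)).1 _).1 h
      exact hc ⟨.inc _ _, trivial, (hT.obj_iff (hocc rfl)).1 h,
        hT _ (.neg_obj hα) (List.mem_singleton_self _)⟩
    | feat y C =>
      intro h
      have h := ((hT.mem_eval (hocc rfl)).2 _).1 h
      exact hc ⟨.inc _ _, trivial, (hT.feat_iff (hocc rfl)).1 h,
        hT _ (.neg_feat hα) (List.mem_singleton_self _)⟩

end

section

variable {O F D : Type} [DecidableEq O] [DecidableEq F] [DecidableEq D]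

theorem Run.subset {E : LocalInverse O F} {T₀ T : Tableau O F D} {n : ℕ} (r : Run E T₀ T n) :
    T₀ ⊆ T := by
  induction r with
  | start => exact List.Subset.refl _
  | step _ _ _ ih => exact fun α hα => List.mem_append_right _ (ih hα)

theorem Run.answer_correct {E : LocalInverse O F} {A : ABox O F D} {T : Tableau O F D} {n : ℕ}
    {ans : Answer} (r : Run E A.toTab T n) (h : Halts E T ans) :
    ans = .consistent ↔ Consistent E A := by
  cases h with
  | clash h => simpa using fun hA => r.not_hasClash_of_consistent hA h
  | complete hc h =>
    have hT : Saturated E T := fun S hS => by_contra fun hST => h S ⟨hS, hST⟩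
    simpa using hT.consistent hc r.subset

end

/-! ## Modal lattices that bound the names and concepts in a tableau -/

/-- The integers, where all modal operators are translations. -/
def translationLattice : ModalLattice ℤ where
  box a := a - 1
  bdia a := a + 1
  dia a := a + 1
  bbox a := a - 1
  gc_box a b := by simp only; omega
  gc_dia a b := by simp only; omega

/-- A chain of six elements. -/
def chainLattice : ModalLattice (Fin 6) where
  -- On the levels 1 to 4, ◆ fixes 2, ◇ fixes 3, and every other application of either strictly
  -- raises the level; level 5 will be forbidden. The map x ↦ 5 - x exchanges □ with ◇ and ■ with ◆.
  -- The axioms hold because ◇1 = ◆1 for objects at level 1 and ■4 = □4 for features at level 4.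
  box := ![0, 0, 2, 2, 3, 5]
  bdia := ![0, 2, 2, 4, 5, 5]
  dia := ![0, 2, 3, 3, 5, 5]
  bbox := ![0, 0, 1, 3, 3, 5]
  gc_box := by unfold GaloisConnection; decide
  gc_dia := by unfold GaloisConnection; decide

section

variable (O F D : Type)

/-- The valuation in the integers, with all objects below `-n` and all features above `n`. -/
def translationValuation (n : ℕ) : Valuation O F D ℤ where
  toModalLattice := translationLattice
  atom _ := 0
  obj _ := -n
  feat _ := n

/-- The valuation in the six-element chain. -/
def chainValuation : Valuation O F D (Fin 6) where
  toModalLattice := chainLattice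
  atom _ := 2
  obj _ := 1
  feat _ := 4

end

/-! ### Truth of the ABox and the axioms in the integers and the chain -/

section

variable {O F D : Type}

theorem translationValuation_holdsAxiom (n : ℕ) (E : LocalInverse O F) :
    (translationValuation O F D n).HoldsAxiom E := by
  cases E <;> simp only [Valuation.HoldsAxiom, translationValuation, translationLattice] <;> omega

theorem chainValuation_holdsAxiom (E : LocalInverse O F) :
    (chainValuation O F D).HoldsAxiom E := by
  cases E <;> simp only [Valuation.HoldsAxiom, chainValuation, chainLattice] <;> decide

theorem abs_translationValuation_concept (n : ℕ) (C : LEConcept D) :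
    |(translationValuation O F D n).concept C| ≤ C.size := by
  induction C with
  | atom d => simp [Valuation.concept, translationValuation]
  | and C₁ C₂ h₁ h₂ =>
    rw [abs_le] at *
    simp only [Valuation.concept, LEConcept.size]
    push_cast
    rcases le_total ((translationValuation O F D n).concept C₁)
      ((translationValuation O F D n).concept C₂) with h | h <;>
        simp only [inf_of_le_left, inf_of_le_right, h] <;> omega
  | or C₁ C₂ h₁ h₂ =>
    rw [abs_le] at *
    simp only [Valuation.concept, LEConcept.size]
    push_cast
    rcases le_total ((translationValuation O F D n).concept C₁)
      ((translationValuation O F D n).concept C₂) with h | h <;>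
        simp only [sup_of_le_left, sup_of_le_right, h] <;> omega
  | box C h =>
    rw [abs_le] at *
    simp only [Valuation.concept, LEConcept.size]
    change _ ≤ (translationValuation O F D n).concept C - 1 ∧
      (translationValuation O F D n).concept C - 1 ≤ _
    push_cast
    omega
  | dia C h =>
    rw [abs_le] at *
    simp only [Valuation.concept, LEConcept.size]
    change _ ≤ (translationValuation O F D n).concept C + 1 ∧
      (translationValuation O F D n).concept C + 1 ≤ _
    push_cast
    omega

/-- The two middle levels are closed under all connectives: □ sends both to 2, ◇ sends both to 3. -/
theorem chainValuation_concept (C : LEConcept D) :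
    (chainValuation O F D).concept C = 2 ∨ (chainValuation O F D).concept C = 3 := by
  induction C with
  | atom d => exact .inl rfl
  | and C₁ C₂ h₁ h₂ => rcases h₁ with h₁ | h₁ <;> rcases h₂ with h₂ | h₂ <;>
      simp [Valuation.concept, h₁, h₂]
  | or C₁ C₂ h₁ h₂ => rcases h₁ with h₁ | h₁ <;> rcases h₂ with h₂ | h₂ <;>
      simp [Valuation.concept, h₁, h₂]
  | box C h =>
    change chainLattice.box ((chainValuation O F D).concept C) = 2 ∨
      chainLattice.box ((chainValuation O F D).concept C) = 3
    rcases h with h | h <;> rw [h] <;> decide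
  | dia C h =>
    change chainLattice.dia ((chainValuation O F D).concept C) = 2 ∨
      chainLattice.dia ((chainValuation O F D).concept C) = 3
    rcases h with h | h <;> rw [h] <;> decide

theorem Assertion.size_le {A : ABox O F D} {α : Assertion O F D} (h : α ∈ A) :
    α.size ≤ A.size :=
  List.single_le_sum (by simp) _ (List.mem_map_of_mem h)

/-- To check the positive assertions of an ABox, it is enough to check each. -/
theorem Valuation.holdsPos_toTab {L : Type*} [Lattice L] {v : Valuation O F D L}
    {A : ABox O F D} (h : ∀ t, .pos t ∈ A → v.Holds (t.map .base .base)) :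
    v.HoldsPos A.toTab := by
  intro t ht
  obtain ⟨α, hα, h'⟩ := List.mem_map.1 ht
  cases α with
  | neg t => simp [Assertion.toTab] at h'
  | pos t =>
    obtain rfl := Assertion.pos.inj h'
    exact h t hα

theorem translationValuation_holdsPos (A : ABox O F D) :
    (translationValuation O F D A.size).HoldsPos A.toTab := by
  refine Valuation.holdsPos_toTab fun t ht => ?_
  have hs := Assertion.size_le ht
  cases t with
  | inc b y => change -(A.size : ℤ) ≤ A.size; omega
  | rbox b y =>
    change -(A.size : ℤ) ≤ A.size - 1
    -- The operator costs one unit, which is available because the term itself makes the ABox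
    -- nonempty in size.
    simp only [Assertion.size, Term.size] at hs
    omega
  | rdia y b =>
    change -(A.size : ℤ) + 1 ≤ A.size
    simp only [Assertion.size, Term.size] at hs
    omega
  | obj b C =>
    have := abs_le.1 (abs_translationValuation_concept (O := O) (F := F) A.size C)
    change -(A.size : ℤ) ≤ (translationValuation O F D A.size).concept C
    simp only [Assertion.size, Term.size] at hs
    omega
  | feat b C =>
    have := abs_le.1 (abs_translationValuation_concept (O := O) (F := F) A.size C)
    change (translationValuation O F D A.size).concept C ≤ A.size
    simp only [Assertion.size, Term.size] at hs
    omega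

theorem chainValuation_holdsPos (A : ABox O F D) :
    (chainValuation O F D).HoldsPos A.toTab := by
  refine Valuation.holdsPos_toTab fun t ht => ?_
  cases t with
  | inc b y => change (1 : Fin 6) ≤ 4; decide
  | rbox b y => change (1 : Fin 6) ≤ 3; decide
  | rdia y b => change (2 : Fin 6) ≤ 4; decide
  | obj b C =>
    change 1 ≤ (chainValuation O F D).concept C
    rcases chainValuation_concept (O := O) (F := F) C with h | h <;> rw [h] <;> decide
  | feat b C =>
    change (chainValuation O F D).concept C ≤ 4
    rcases chainValuation_concept (O := O) (F := F) C with h | h <;> rw [h] <;> decide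

end

/-! ### Modal paths -/

/-- Words of modal operators (`true` for `□` and `false` for `◇`) and two markers. -/
inductive PathPoint : Type
  | word : List Bool → PathPoint
  | mark : PathPoint
  | infty : PathPoint

namespace PathPoint

/-- The points generated by a point under the operator `c` that preserves unions. -/
def succ (c : Bool) : PathPoint → Set PathPoint
  | .word w => {.word [], .word (c :: w)}
  | _ => {.infty}

/-- The points required by a point under the operator `c` that preserves intersections. -/
def pred (P : Set (List Bool)) (c : Bool) : PathPoint → Set PathPoint
  | .word [] => ∅
  | .word (x :: w) => {g | (x = c → g = .word w) ∧ (x ≠ c → x :: w ∈ P → g = .mark) ∧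
      (x ≠ c → x :: w ∉ P → g = .infty)}
  | _ => {.infty}

/-- The lattice of sets of points. The operator `◇` puts the letter `c` in front of words, and
preserves unions; the operator `□` puts the letter `!c` in front of words, and preserves
intersections. -/
def lattice (P : Set (List Bool)) (c : Bool) : ModalLattice (Set PathPoint) where
  dia U := {h | ∃ g ∈ U, h ∈ succ c g}
  bbox U := {g | succ c g ⊆ U}
  box U := {g | pred P (!c) g ⊆ U}
  bdia U := {h | ∃ g ∈ U, h ∈ pred P (!c) g}
  gc_box _ _ := ⟨fun h _ hg _ hh => h ⟨_, hg, hh⟩, fun h _ ⟨_, hg, hh⟩ => h hg hh⟩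
  gc_dia _ _ := ⟨fun h _ hg _ hh => h ⟨_, hg, hh⟩, fun h _ ⟨_, hg, hh⟩ => h hg hh⟩

variable {P : Set (List Bool)} {c : Bool} {U V : Set PathPoint} {w : List Bool}

/-- The set of words in `P`, with the marker. -/
def base (P : Set (List Bool)) : Set PathPoint :=
  {g | g = .mark ∨ ∃ w ∈ P, g = .word w}

/-- All words in `U` that start with the letter `c` are in `P`. -/
def Tame (P : Set (List Bool)) (c : Bool) (U : Set PathPoint) : Prop :=
  .infty ∉ U ∧ ∀ w, .word (c :: w) ∈ U → c :: w ∈ P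

theorem Tame.mono (h : Tame P c V) (hU : U ⊆ V) : Tame P c U :=
  ⟨fun h' => h.1 (hU h'), fun w hw => h.2 w (hU hw)⟩

theorem tame_base : Tame P c (base P) := by
  refine ⟨by simp [base], fun w hw => ?_⟩
  simpa [base] using hw

theorem word_cons_mem_dia (h : .word w ∈ U) : .word (c :: w) ∈ (lattice P c).dia U :=
  ⟨_, h, by simp [succ]⟩

theorem word_cons_mem_box (h : .word w ∈ U) : .word ((!c) :: w) ∈ (lattice P c).box U := by
  simpa [lattice, pred] using h

/-- A word c :: w survives only if c :: c :: w lies in U, hence in P, and P is closed under dropping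
the first letter. -/
theorem Tame.bbox (h : Tame P c U) (hP : ∀ x w, x :: w ∈ P → w ∈ P) :
    Tame P c ((lattice P c).bbox U) := by
  refine ⟨fun h' => h.1 (h' (by simp [succ])), fun w hw => ?_⟩
  exact hP _ _ (h.2 _ (hw (by simp [succ])))

/-- A word with first letter c outside P requires the point `infty`, which U does not contain. -/
theorem Tame.box (h : Tame P c U) : Tame P c ((lattice P c).box U) := by
  refine ⟨fun h' => h.1 (h' (by simp [pred])), fun w hw => ?_⟩
  by_contra hP
  exact h.1 (hw (by simp [pred, hP]))

theorem lattice_dia_empty : (lattice P c).dia ∅ = ∅ := by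
  simp [lattice]

/-- The additional axiom for the set `base P`. -/
theorem subset_box_base (hP : ∀ x w, x :: w ∈ P → w ∈ P) (h : (lattice P c).dia U ⊆ base P) :
    U ⊆ (lattice P c).box (base P) := by
  intro g hg
  rcases g with w | _ | _
  · have hw : w ∈ P := by
      have : .word (c :: w) ∈ base P := h (word_cons_mem_dia hg)
      exact hP c w (by simpa [base] using this)
    change pred _ _ _ ⊆ _
    rcases w with _ | ⟨x, w⟩
    · simp [pred]
    · intro g hg
      by_cases hx : x = !c
      · obtain rfl := hg.1 hx
        exact .inr ⟨_, hP _ _ hw, rfl⟩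
      -- Here x = c and the word is in P. This is the purpose of `mark`: it belongs to `base P`, so
      -- such words pass, while those outside P are still stopped by `infty`.
      · obtain rfl := hg.2.1 hx hw
        exact .inl rfl
  · exact absurd (h ⟨_, hg, rfl⟩) (by simp [base])
  · exact absurd (h ⟨_, hg, rfl⟩) (by simp [base])

end PathPoint

/-- The words of modal operators on the way from the root of a concept to one of its nodes. -/
def LEConcept.paths {D : Type} : LEConcept D → Finset (List Bool)
  | .atom _ => {[]}
  | .and C₁ C₂ => C₁.paths ∪ C₂.paths
  | .or C₁ C₂ => C₁.paths ∪ C₂.paths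
  | .box C => insert [] (C.paths.image (true :: ·))
  | .dia C => insert [] (C.paths.image (false :: ·))

/-! ### Number, length and suffixes of modal paths -/

namespace LEConcept

variable {D : Type}

theorem nil_mem_paths (C : LEConcept D) : [] ∈ C.paths := by
  induction C <;> simp_all [paths]

/-- Dropping the first modality of a path means passing to the argument of that modality; hence the
paths of an ABox are closed under this operation. -/
theorem exists_sub_of_cons_mem_paths {C : LEConcept D} {x : Bool} {w : List Bool}
    (h : x :: w ∈ C.paths) : ∃ C', C.Sub C' ∧ w ∈ C'.paths := by
  induction C with
  | atom d => simp [paths] at h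
  | and C₁ C₂ h₁ h₂ =>
    rcases Finset.mem_union.1 h with h | h
    · obtain ⟨C', hs, hw⟩ := h₁ h
      exact ⟨C', .inr (.inl hs), hw⟩
    · obtain ⟨C', hs, hw⟩ := h₂ h
      exact ⟨C', .inr (.inr hs), hw⟩
  | or C₁ C₂ h₁ h₂ =>
    rcases Finset.mem_union.1 h with h | h
    · obtain ⟨C', hs, hw⟩ := h₁ h
      exact ⟨C', .inr (.inl hs), hw⟩
    · obtain ⟨C', hs, hw⟩ := h₂ h
      exact ⟨C', .inr (.inr hs), hw⟩
  | box C _ => exact ⟨C, .inr (.refl C), by simp [paths] at h; exact h.1⟩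
  | dia C _ => exact ⟨C, .inr (.refl C), by simp [paths] at h; exact h.1⟩

theorem card_paths_le (C : LEConcept D) : C.paths.card ≤ C.size := by
  induction C with
  | atom d => simp [paths, size]
  | and C₁ C₂ h₁ h₂ => exact (Finset.card_union_le _ _).trans (by simp only [size]; omega)
  | or C₁ C₂ h₁ h₂ => exact (Finset.card_union_le _ _).trans (by simp only [size]; omega)
  | box C h => exact (Finset.card_insert_le _ _).trans (by
      have := Finset.card_image_le (s := C.paths) (f := (true :: ·)); simp only [size]; omega)
  | dia C h => exact (Finset.card_insert_le _ _).trans (by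
      have := Finset.card_image_le (s := C.paths) (f := (false :: ·)); simp only [size]; omega)

theorem length_le_of_mem_paths {C : LEConcept D} {w : List Bool} (h : w ∈ C.paths) :
    w.length ≤ C.size := by
  induction C generalizing w with
  | atom d => simp_all [paths, size]
  | and C₁ C₂ h₁ h₂ =>
    simp only [size]
    rcases Finset.mem_union.1 h with h | h
    · exact (h₁ h).trans (by omega)
    · exact (h₂ h).trans (by omega)
  | or C₁ C₂ h₁ h₂ =>
    simp only [size]
    rcases Finset.mem_union.1 h with h | h
    · exact (h₁ h).trans (by omega)
    · exact (h₂ h).trans (by omega)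
  | box C ih =>
    simp only [paths, Finset.mem_insert, Finset.mem_image] at h
    rcases h with rfl | ⟨w, hw, rfl⟩
    · simp
    · simpa [size] using ih hw
  | dia C ih =>
    simp only [paths, Finset.mem_insert, Finset.mem_image] at h
    rcases h with rfl | ⟨w, hw, rfl⟩
    · simp
    · simpa [size] using ih hw

end LEConcept

section

variable {O F D : Type}

/-- The modal paths in the concepts of an ABox. -/
def ABox.paths (A : ABox O F D) : Set (List Bool) :=
  {w | ∃ C, Occurs A.toTab C ∧ w ∈ C.paths}

theorem ABox.mem_paths_of_cons {A : ABox O F D} (x : Bool) (w : List Bool)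
    (h : x :: w ∈ A.paths) : w ∈ A.paths := by
  obtain ⟨C, hC, hw⟩ := h
  obtain ⟨C', hs, hw⟩ := LEConcept.exists_sub_of_cons_mem_paths hw
  exact ⟨C', hC.sub hs, hw⟩

/-- The valuation by modal paths that bounds the concepts `□C`. -/
def ABox.boxValuation (A : ABox O F D) : Valuation O F D (Set PathPoint)ᵒᵈ where
  toModalLattice := (PathPoint.lattice A.paths true).dual
  atom _ := .toDual {.word []}
  obj _ := .toDual (PathPoint.base A.paths)
  feat _ := .toDual ∅

/-- The valuation by modal paths that bounds the concepts `◇C`. -/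
def ABox.diaValuation (A : ABox O F D) : Valuation O F D (Set PathPoint) where
  toModalLattice := PathPoint.lattice A.paths false
  atom _ := {.word []}
  obj _ := ∅
  feat _ := PathPoint.base A.paths

/-- The points given by the words in a finite set. -/
def PathPoint.ofWords (W : Finset (List Bool)) : Set PathPoint :=
  {g | ∃ w ∈ W, g = .word w}

theorem PathPoint.dia_subset_ofWords {P : Set (List Bool)} {c : Bool} {W : Finset (List Bool)}
    {U : Set PathPoint} (h : U ⊆ ofWords W) :
    (lattice P c).dia U ⊆ ofWords (insert [] (W.image (c :: ·))) := by
  rintro g ⟨g', hg', hg⟩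
  obtain ⟨w, hw, rfl⟩ := h hg'
  rcases hg with rfl | rfl
  · exact ⟨[], by simp, rfl⟩
  · exact ⟨c :: w, by simp [hw], rfl⟩

theorem PathPoint.box_subset_ofWords {P : Set (List Bool)} {c : Bool} {W : Finset (List Bool)}
    {U : Set PathPoint} (h : U ⊆ ofWords W) :
    (lattice P c).box U ⊆ ofWords (insert [] (W.image ((!c) :: ·))) := by
  have h₁ : .mark ∉ U := fun h' => by simpa [ofWords] using h h'
  have h₂ : .infty ∉ U := fun h' => by simpa [ofWords] using h h'
  intro g hg
  change pred _ _ _ ⊆ _ at hg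
  rcases g with (_ | ⟨x, w⟩) | _ | _
  · exact ⟨[], by simp, rfl⟩
  · by_cases hx : x = !c
    · subst hx
      have : .word w ∈ U := hg (by simp [pred])
      obtain ⟨w', hw, h⟩ := h this
      obtain rfl := PathPoint.word.inj h
      exact ⟨_, by simp [hw], rfl⟩
    · by_cases hP : x :: w ∈ P
      · exact absurd (hg (a := .mark) (by simp [pred, hP, hx])) h₁
      · exact absurd (hg (a := .infty) (by simp [pred, hP, hx])) h₂
  · exact absurd (hg rfl) h₂
  · exact absurd (hg rfl) h₂

/-- Box-headed words do not occur in a value of `◇`, and the other way around. -/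
theorem PathPoint.tame_box_of_subset {P : Set (List Bool)} {c : Bool} {W : Finset (List Bool)}
    {U : Set PathPoint} (h : U ⊆ ofWords W) : Tame P c ((lattice P c).box U) := by
  have h' := box_subset_ofWords (P := P) (c := c) h
  refine ⟨fun hi => by simpa [ofWords] using h' hi, fun w hw => ?_⟩
  simpa [ofWords] using h' hw

/-- In the order dual, meets are unions and □ is the union-preserving operator, so both modalities
still put their own letter in front of words. -/
theorem ABox.boxValuation_concept_subset (A : ABox O F D) (C : LEConcept D) :
    (A.boxValuation.concept C).ofDual ⊆ PathPoint.ofWords C.paths := by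
  induction C with
  | atom d => intro g hg; exact ⟨[], by simp [LEConcept.paths], hg⟩
  | and C₁ C₂ h₁ h₂ =>
    rintro g (hg | hg)
    · obtain ⟨w, hw, rfl⟩ := h₁ hg
      exact ⟨w, by simp [LEConcept.paths, hw], rfl⟩
    · obtain ⟨w, hw, rfl⟩ := h₂ hg
      exact ⟨w, by simp [LEConcept.paths, hw], rfl⟩
  | or C₁ C₂ h₁ h₂ =>
    rintro g ⟨hg, -⟩
    obtain ⟨w, hw, rfl⟩ := h₁ hg
    exact ⟨w, by simp [LEConcept.paths, hw], rfl⟩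
  | box C h => exact PathPoint.dia_subset_ofWords (P := A.paths) (c := true) h
  | dia C h => exact PathPoint.box_subset_ofWords (P := A.paths) (c := true) h

theorem ABox.diaValuation_concept_subset (A : ABox O F D) (C : LEConcept D) :
    A.diaValuation.concept C ⊆ PathPoint.ofWords C.paths := by
  induction C with
  | atom d => intro g hg; exact ⟨[], by simp [LEConcept.paths], hg⟩
  | or C₁ C₂ h₁ h₂ =>
    rintro g (hg | hg)
    · obtain ⟨w, hw, rfl⟩ := h₁ hg
      exact ⟨w, by simp [LEConcept.paths, hw], rfl⟩
    · obtain ⟨w, hw, rfl⟩ := h₂ hg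
      exact ⟨w, by simp [LEConcept.paths, hw], rfl⟩
  | and C₁ C₂ h₁ h₂ =>
    rintro g ⟨hg, -⟩
    obtain ⟨w, hw, rfl⟩ := h₁ hg
    exact ⟨w, by simp [LEConcept.paths, hw], rfl⟩
  | dia C h => exact PathPoint.dia_subset_ofWords (P := A.paths) (c := false) h
  | box C h => exact PathPoint.box_subset_ofWords (P := A.paths) (c := false) h

/-- Every value contains the empty word, since `succ` always adds it and `pred` requires nothing of
it. It is the seed from which the words of a modal prefix grow. -/
theorem ABox.nil_mem_boxValuation (A : ABox O F D) (C : LEConcept D) :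
    .word [] ∈ (A.boxValuation.concept C).ofDual := by
  induction C with
  | atom d => rfl
  | and C₁ C₂ h₁ h₂ => exact .inl h₁
  | or C₁ C₂ h₁ h₂ => exact ⟨h₁, h₂⟩
  | box C h => exact ⟨_, h, .inl rfl⟩
  | dia C h => exact Set.empty_subset _

theorem ABox.nil_mem_diaValuation (A : ABox O F D) (C : LEConcept D) :
    .word [] ∈ A.diaValuation.concept C := by
  induction C with
  | atom d => rfl
  | and C₁ C₂ h₁ h₂ => exact ⟨h₁, h₂⟩
  | or C₁ C₂ h₁ h₂ => exact .inl h₁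
  | dia C h => exact ⟨_, h, .inl rfl⟩
  | box C h => exact Set.empty_subset _

theorem ABox.ofWords_subset_base {A : ABox O F D} {C : LEConcept D} (hC : Occurs A.toTab C) :
    PathPoint.ofWords C.paths ⊆ PathPoint.base A.paths := by
  rintro g ⟨w, hw, rfl⟩
  exact .inr ⟨w, ⟨C, hC, hw⟩, rfl⟩

theorem ABox.occurs_of_mem {A : ABox O F D} {t : Term O F D} (ht : .pos t ∈ A)
    {C : LEConcept D} (hC : t.concept? = some C) : Occurs A.toTab C :=
  ⟨_, List.mem_map_of_mem ht, C, by cases t <;> exact hC, .refl C⟩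

/-- Only `SA` has content. For `SX` the feature has the value ∅, which the union-preserving operator
keeps empty. -/
theorem ABox.boxValuation_holdsAxiom (A : ABox O F D) (E : LocalInverse O F) :
    A.boxValuation.HoldsAxiom E := by
  cases E with
  | SA b => exact fun p hp => PathPoint.subset_box_base A.mem_paths_of_cons hp
  | SX y =>
    intro p _
    change (PathPoint.lattice A.paths true).dia ∅ ⊆ p.ofDual
    simp [PathPoint.lattice_dia_empty]

theorem ABox.diaValuation_holdsAxiom (A : ABox O F D) (E : LocalInverse O F) :
    A.diaValuation.HoldsAxiom E := by
  cases E with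
  | SX b => exact fun p hp => PathPoint.subset_box_base A.mem_paths_of_cons hp
  | SA y =>
    intro p _
    change (PathPoint.lattice A.paths false).dia ∅ ⊆ p
    simp [PathPoint.lattice_dia_empty]

theorem ABox.boxValuation_holdsPos (A : ABox O F D) : A.boxValuation.HoldsPos A.toTab := by
  refine Valuation.holdsPos_toTab fun t ht => ?_
  cases t with
  | inc b y => exact Set.empty_subset _
  | rbox b y =>
    change (PathPoint.lattice A.paths true).dia ∅ ⊆ PathPoint.base A.paths
    simp [PathPoint.lattice_dia_empty]
  | rdia y b => exact Set.empty_subset _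
  | obj b C =>
    exact (A.boxValuation_concept_subset C).trans (ofWords_subset_base (occurs_of_mem ht rfl))
  | feat y C => exact Set.empty_subset _

theorem ABox.diaValuation_holdsPos (A : ABox O F D) : A.diaValuation.HoldsPos A.toTab := by
  refine Valuation.holdsPos_toTab fun t ht => ?_
  cases t with
  | inc b y => exact Set.empty_subset _
  | rdia b y =>
    change (PathPoint.lattice A.paths false).dia ∅ ⊆ PathPoint.base A.paths
    simp [PathPoint.lattice_dia_empty]
  | rbox y b => exact Set.empty_subset _
  | feat y C =>
    exact (A.diaValuation_concept_subset C).trans (ofWords_subset_base (occurs_of_mem ht rfl))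
  | obj b C => exact Set.empty_subset _

/-! ### The concepts and names that appear in tableaux -/

/-- Bounds for the concepts that appear in a tableau for `A`. -/
inductive ABox.Admits (A : ABox O F D) : LEConcept D → Prop
  | occurs {C} : Occurs A.toTab C → A.Admits C
  | box {C} : A.Admits C → PathPoint.Tame A.paths true (A.boxValuation.concept C.box).ofDual →
      A.Admits C.box
  | dia {C} : A.Admits C → PathPoint.Tame A.paths false (A.diaValuation.concept C.dia) →
      A.Admits C.dia

namespace ABox

variable {A : ABox O F D}

theorem Admits.sub {C C' : LEConcept D} (h : A.Admits C) (h' : C.Sub C') : A.Admits C' := by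
  induction h with
  | occurs h => exact .occurs (h.sub h')
  | box hC ht ih =>
    rcases h' with rfl | h'
    exacts [.box hC ht, ih h']
  | dia hC ht ih =>
    rcases h' with rfl | h'
    exacts [.dia hC ht, ih h']

theorem Admits.tame {C : LEConcept D} (h : A.Admits C) :
    PathPoint.Tame A.paths true (A.boxValuation.concept C).ofDual ∧
      PathPoint.Tame A.paths false (A.diaValuation.concept C) := by
  cases h with
  | occurs h =>
    have := ofWords_subset_base h
    exact ⟨PathPoint.tame_base.mono ((A.boxValuation_concept_subset C).trans this),
      PathPoint.tame_base.mono ((A.diaValuation_concept_subset C).trans this)⟩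
  | box hC ht => exact ⟨ht, PathPoint.tame_box_of_subset (A.diaValuation_concept_subset _)⟩
  | dia hC ht => exact ⟨PathPoint.tame_box_of_subset (A.boxValuation_concept_subset _), ht⟩

end ABox

/-- The concept with a word of modal operators in front. -/
def LEConcept.prefixed (C : LEConcept D) : List Bool → LEConcept D
  | [] => C
  | true :: w => (C.prefixed w).box
  | false :: w => (C.prefixed w).dia

theorem ABox.word_mem_boxValuation (A : ABox O F D) (C : LEConcept D) (w : List Bool) :
    .word w ∈ (A.boxValuation.concept (C.prefixed w)).ofDual := by
  induction w with
  | nil => exact A.nil_mem_boxValuation C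
  | cons x w ih =>
    cases x with
    | true => exact PathPoint.word_cons_mem_dia (P := A.paths) (c := true) ih
    | false => exact PathPoint.word_cons_mem_box (P := A.paths) (c := true) ih

theorem ABox.word_mem_diaValuation (A : ABox O F D) (C : LEConcept D) (w : List Bool) :
    .word w ∈ A.diaValuation.concept (C.prefixed w) := by
  induction w with
  | nil => exact A.nil_mem_diaValuation C
  | cons x w ih =>
    cases x with
    | true => exact PathPoint.word_cons_mem_box (P := A.paths) (c := false) ih
    | false => exact PathPoint.word_cons_mem_dia (P := A.paths) (c := false) ih

/-- The value of C' under the prefix w contains the word w itself. Tameness of that value therefore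
says that the prefix spells a modal path of the ABox, at each step for the outermost letter added.
-/
theorem ABox.Admits.exists_prefixed {A : ABox O F D} {C : LEConcept D} (h : A.Admits C) :
    ∃ C' w, Occurs A.toTab C' ∧ w ∈ A.paths ∧ C = C'.prefixed w := by
  induction h with
  | @occurs C h => exact ⟨C, [], h, ⟨C, h, C.nil_mem_paths⟩, rfl⟩
  | box _ ht ih =>
    obtain ⟨C', w, h, -, rfl⟩ := ih
    exact ⟨C', true :: w, h, ht.2 w (A.word_mem_boxValuation C' (true :: w)), rfl⟩
  | dia _ ht ih =>
    obtain ⟨C', w, h, -, rfl⟩ := ih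
    exact ⟨C', false :: w, h, ht.2 w (A.word_mem_diaValuation C' (false :: w)), rfl⟩

end

section

variable {O F D : Type}

/-- The object name, if any, in a term. -/
def Term.obj? : Term O F D → Option O
  | .inc b _ => some b
  | .rbox b _ => some b
  | .rdia _ b => some b
  | .obj b _ => some b
  | .feat _ _ => none

/-- The feature name, if any, in a term. -/
def Term.feat? : Term O F D → Option F
  | .inc _ y => some y
  | .rbox _ y => some y
  | .rdia y _ => some y
  | .obj _ _ => none
  | .feat y _ => some y

/-- The term of an assertion. -/
def Assertion.term : Assertion O F D → Term O F D
  | .pos t => t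
  | .neg t => t

/-- The object names in an ABox. -/
def ABox.objs (A : ABox O F D) : List O :=
  A.filterMap (·.term.obj?)

/-- The feature names in an ABox. -/
def ABox.feats (A : ABox O F D) : List F :=
  A.filterMap (·.term.feat?)

/-- All concepts and names in `b` are admitted. -/
def ABox.AdmitsObj (A : ABox O F D) : ObjName O D → Prop
  | .base b => b ∈ A.objs
  | .cls C => A.Admits C
  | .bdia b => A.AdmitsObj b
  | .dia b => A.AdmitsObj b

/-- All concepts and names in `y` are admitted. -/
def ABox.AdmitsFeat (A : ABox O F D) : FeatName F D → Prop
  | .base y => y ∈ A.feats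
  | .cls C => A.Admits C
  | .box y => A.AdmitsFeat y
  | .bbox y => A.AdmitsFeat y

/-- All concepts and names in the term are admitted. -/
def ABox.AdmitsTerm (A : ABox O F D) (t : Term (ObjName O D) (FeatName F D) D) : Prop :=
  (∀ b, t.obj? = some b → A.AdmitsObj b) ∧ (∀ y, t.feat? = some y → A.AdmitsFeat y) ∧
    ∀ C, t.concept? = some C → A.Admits C

/-- All concepts and names in the tableau are admitted. -/
def ABox.AdmitsTableau (A : ABox O F D) (T : Tableau O F D) : Prop :=
  ∀ α ∈ T, A.AdmitsTerm α.term

variable {A : ABox O F D}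

/-- In the dual lattice ◆ and ◇ on objects are the operators `bbox` and `box` of the path lattice,
which both preserve tameness. -/
theorem ABox.AdmitsObj.tame {b : ObjName O D} (h : A.AdmitsObj b) :
    PathPoint.Tame A.paths true (A.boxValuation.objName b).ofDual := by
  induction b with
  | base b => exact PathPoint.tame_base
  | cls C => exact (ABox.Admits.tame h).1
  | bdia b ih => exact (ih h).bbox A.mem_paths_of_cons
  | dia b ih => exact (ih h).box

theorem ABox.AdmitsFeat.tame {y : FeatName F D} (h : A.AdmitsFeat y) :
    PathPoint.Tame A.paths false (A.diaValuation.featName y) := by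
  induction y with
  | base b => exact PathPoint.tame_base
  | cls C => exact (ABox.Admits.tame h).2
  | bbox b ih => exact (ih h).bbox A.mem_paths_of_cons
  | box b ih => exact (ih h).box

theorem ABox.AdmitsObj.of_mkDia {b : ObjName O D} (h : A.AdmitsObj b.mkDia) : A.AdmitsObj b := by
  cases b with
  | cls C => exact ABox.Admits.sub h (.inr (.refl C))
  | _ => exact h

theorem ABox.AdmitsFeat.of_mkBox {y : FeatName F D} (h : A.AdmitsFeat y.mkBox) :
    A.AdmitsFeat y := by
  cases y with
  | cls C => exact ABox.Admits.sub h (.inr (.refl C))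
  | _ => exact h

/-- For b = a_C a new concept ◇C may arise here. The truth of y R_◇ a_C places its value inside the
tame value of y, and tameness passes to subsets. -/
theorem ABox.AdmitsObj.mkDia {b : ObjName O D} {y : FeatName F D} (hb : A.AdmitsObj b)
    (hy : A.AdmitsFeat y) (h : A.diaValuation.Holds (.rdia y b)) : A.AdmitsObj b.mkDia := by
  cases b with
  | cls C => exact .dia hb (hy.tame.mono h)
  | _ => exact hb

theorem ABox.AdmitsFeat.mkBox {b : ObjName O D} {y : FeatName F D} (hb : A.AdmitsObj b)
    (hy : A.AdmitsFeat y) (h : A.boxValuation.Holds (.rbox b y)) : A.AdmitsFeat y.mkBox := by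
  cases y with
  | cls C => exact .box hy (hb.tame.mono h)
  | _ => exact hy

theorem ABox.AdmitsTableau.occurs {T : Tableau O F D} (h : A.AdmitsTableau T) {C : LEConcept D}
    (hC : Occurs T C) : A.Admits C := by
  obtain ⟨α, hα, C', hC', hs⟩ := hC
  refine ((h α hα).2.2 C' ?_).sub hs
  cases α <;> exact hC'

theorem ABox.admitsTableau_toTab (A : ABox O F D) : A.AdmitsTableau A.toTab := by
  intro α hα
  have hC (C) (h : α.concept? = some C) : A.Admits C := .occurs ⟨α, hα, C, h, .refl C⟩
  obtain ⟨β, hβ, rfl⟩ := List.mem_map.1 hα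
  have hb (b) (h : β.term.obj? = some b) : b ∈ A.objs := List.mem_filterMap.2 ⟨β, hβ, h⟩
  have hy (y) (h : β.term.feat? = some y) : y ∈ A.feats := List.mem_filterMap.2 ⟨β, hβ, h⟩
  rcases β with t | t <;> cases t <;>
    simp_all [Assertion.term, ABox.AdmitsTerm, Term.obj?, Term.feat?, Term.concept?,
      Assertion.concept?, Assertion.toTab, Term.map, ABox.AdmitsObj, ABox.AdmitsFeat]

theorem ABox.AdmitsTableau.append {S T : Tableau O F D} (hS : A.AdmitsTableau S)
    (hT : A.AdmitsTableau T) : A.AdmitsTableau (S ++ T) :=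
  fun α hα => (List.mem_append.1 hα).elim (hS α) (hT α)

section

variable {b : ObjName O D} {y : FeatName F D} {C : LEConcept D}

@[simp] theorem ABox.admitsTerm_inc :
    A.AdmitsTerm (.inc b y) ↔ A.AdmitsObj b ∧ A.AdmitsFeat y := by
  simp [ABox.AdmitsTerm, Term.obj?, Term.feat?, Term.concept?]

@[simp] theorem ABox.admitsTerm_rbox :
    A.AdmitsTerm (.rbox b y) ↔ A.AdmitsObj b ∧ A.AdmitsFeat y := by
  simp [ABox.AdmitsTerm, Term.obj?, Term.feat?, Term.concept?]

@[simp] theorem ABox.admitsTerm_rdia :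
    A.AdmitsTerm (.rdia y b) ↔ A.AdmitsObj b ∧ A.AdmitsFeat y := by
  simp [ABox.AdmitsTerm, Term.obj?, Term.feat?, Term.concept?]

@[simp] theorem ABox.admitsTerm_obj :
    A.AdmitsTerm (.obj b C) ↔ A.AdmitsObj b ∧ A.Admits C := by
  simp [ABox.AdmitsTerm, Term.obj?, Term.feat?, Term.concept?]

@[simp] theorem ABox.admitsTerm_feat :
    A.AdmitsTerm (.feat y C) ↔ A.AdmitsFeat y ∧ A.Admits C := by
  simp [ABox.AdmitsTerm, Term.obj?, Term.feat?, Term.concept?]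

end

/-- Only the adjunction rules can lead to new concepts; these two cases use the path valuations, all
others inherit admission from the premises. -/
theorem ABox.AdmitsTableau.rule {E : LocalInverse O F} {T S : Tableau O F D}
    (h : A.AdmitsTableau T) (hb : A.boxValuation.HoldsPos T) (hd : A.diaValuation.HoldsPos T)
    (r : Rule E T S) : A.AdmitsTableau S := by
  cases r with
  | create hC =>
    have hC := h.occurs hC
    simpa [ABox.AdmitsTableau, Assertion.term, ABox.AdmitsObj, ABox.AdmitsFeat] using hC
  | adj_box h₁ =>
    have h₂ := h _ h₁
    simp only [Assertion.term, ABox.admitsTerm_rbox] at h₂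
    simpa [ABox.AdmitsTableau, Assertion.term, h₂, ABox.AdmitsObj] using h₂.2.mkBox h₂.1 (hb _ h₁)
  | adj_dia h₁ =>
    have h₂ := h _ h₁
    simp only [Assertion.term, ABox.admitsTerm_rdia] at h₂
    simpa [ABox.AdmitsTableau, Assertion.term, h₂, ABox.AdmitsFeat] using h₂.1.mkDia h₂.2 (hd _ h₁)
  | of_box h₁ =>
    have h₁ := h _ h₁
    simp only [Assertion.term, ABox.admitsTerm_inc] at h₁
    simpa [ABox.AdmitsTableau, Assertion.term, h₁] using h₁.2.of_mkBox
  | of_dia h₁ =>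
    have h₁ := h _ h₁
    simp only [Assertion.term, ABox.admitsTerm_inc] at h₁
    simpa [ABox.AdmitsTableau, Assertion.term, h₁] using h₁.1.of_mkDia
  | and_elim h₁ =>
    have h₁ := h _ h₁
    simp only [Assertion.term, ABox.admitsTerm_obj] at h₁
    simpa [ABox.AdmitsTableau, Assertion.term, h₁] using
      ⟨h₁.2.sub (.inr (.inl (.refl _))), h₁.2.sub (.inr (.inr (.refl _)))⟩
  | or_elim h₁ =>
    have h₁ := h _ h₁
    simp only [Assertion.term, ABox.admitsTerm_feat] at h₁
    simpa [ABox.AdmitsTableau, Assertion.term, h₁] using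
      ⟨h₁.2.sub (.inr (.inl (.refl _))), h₁.2.sub (.inr (.inr (.refl _)))⟩
  | and_intro h₁ h₂ hC =>
    have hC := h.occurs hC
    have h₁ := h _ h₁
    simp_all [ABox.AdmitsTableau, Assertion.term]
  | or_intro h₁ h₂ hC =>
    have hC := h.occurs hC
    have h₁ := h _ h₁
    simp_all [ABox.AdmitsTableau, Assertion.term]
  | basic h₁ h₂ | box h₁ h₂ | dia h₁ h₂ =>
    have h₁ := h _ h₁
    have h₂ := h _ h₂
    simp_all [ABox.AdmitsTableau, Assertion.term]
  | of_bbox h₁ | of_bdia h₁ | neg_obj h₁ | neg_feat h₁ | app_feat h₁ | app_obj h₁ | SA _ h₁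
  | SX _ h₁ =>
    have h₁ := h _ h₁
    simp_all [ABox.AdmitsTableau, Assertion.term, ABox.AdmitsFeat, ABox.AdmitsObj]

/-! ### Bounds for single names -/

/-- The number of modal operators on an object name. -/
def ObjName.depth : ObjName O D → ℕ
  | .base _ => 0
  | .cls _ => 0
  | .bdia b => b.depth + 1
  | .dia b => b.depth + 1

/-- The number of modal operators on a feature name. -/
def FeatName.depth : FeatName F D → ℕ
  | .base _ => 0
  | .cls _ => 0
  | .box y => y.depth + 1
  | .bbox y => y.depth + 1

/-- No modal operators stand on the names in negative assertions. -/
def NegFlat (T : Tableau O F D) : Prop :=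
  ∀ t, .neg t ∈ T → (∀ b, t.obj? = some b → b.depth = 0) ∧ ∀ y, t.feat? = some y → y.depth = 0

theorem NegFlat.append {S T : Tableau O F D} (hS : NegFlat S) (hT : NegFlat T) :
    NegFlat (S ++ T) :=
  fun t ht => (List.mem_append.1 ht).elim (hS t) (hT t)

theorem ABox.negFlat_toTab (A : ABox O F D) : NegFlat A.toTab := by
  intro t ht
  obtain ⟨β, hβ, h⟩ := List.mem_map.1 ht
  rcases β with t | t
  · simp [Assertion.toTab] at h
  · obtain rfl := Assertion.neg.inj h
    cases t <;> simp [Term.map, Term.obj?, Term.feat?, ObjName.depth, FeatName.depth]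

theorem NegFlat.rule {E : LocalInverse O F} {T S : Tableau O F D} (h : NegFlat T)
    (r : Rule E T S) : NegFlat S := by
  cases r with
  | neg_obj h₁ | neg_feat h₁ =>
    have h₁ := h _ h₁
    simp_all [NegFlat, Term.obj?, Term.feat?, ObjName.depth, FeatName.depth]
  | _ => simp [NegFlat]

theorem LEConcept.Sub.size_le {C C' : LEConcept D} (h : C.Sub C') : C'.size ≤ C.size := by
  induction C with
  | atom d => obtain rfl : C' = _ := h; rfl
  | and C₁ C₂ h₁ h₂ | or C₁ C₂ h₁ h₂ =>
    rcases h with rfl | h | h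
    · rfl
    · have := h₁ h; simp only [size]; omega
    · have := h₂ h; simp only [size]; omega
  | box C ih | dia C ih =>
    rcases h with rfl | h
    · rfl
    · have := ih h; simp only [size]; omega

theorem ABox.size_le_of_occurs {C : LEConcept D} (h : Occurs A.toTab C) : C.size ≤ A.size := by
  obtain ⟨α, hα, C', hC', hs⟩ := h
  obtain ⟨β, hβ, rfl⟩ := List.mem_map.1 hα
  refine hs.size_le.trans (le_trans ?_ (Assertion.size_le hβ))
  rcases β with t | t <;> cases t <;>
    simp_all [Assertion.concept?, Assertion.toTab, Term.concept?, Term.map, Assertion.size,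
      Term.size] <;> omega

theorem LEConcept.size_prefixed (C : LEConcept D) (w : List Bool) :
    (C.prefixed w).size = C.size + w.length := by
  induction w with
  | nil => rfl
  | cons x w ih => cases x <;> simp [prefixed, size, ih] <;> omega

/-- An occurring concept and a path of another one contribute at most n each. -/
theorem ABox.Admits.size_le {C : LEConcept D} (h : A.Admits C) : C.size ≤ 2 * A.size := by
  obtain ⟨C', w, hC', ⟨C'', hC'', hw⟩, rfl⟩ := h.exists_prefixed
  rw [LEConcept.size_prefixed]
  have h₁ := size_le_of_occurs hC'
  have h₂ := size_le_of_occurs hC''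
  have h₃ := LEConcept.length_le_of_mem_paths hw
  omega

/-- Each operator on an object raises its value by one, starting from at least -2n: original names
sit at -n, and admitted concepts have size at most 2n. -/
theorem ABox.AdmitsObj.translation {b : ObjName O D} (h : A.AdmitsObj b) :
    -(2 * A.size : ℤ) + b.depth ≤ (translationValuation O F D A.size).objName b := by
  induction b with
  | base b => change _ ≤ -(A.size : ℤ); simp only [ObjName.depth]; omega
  | cls C =>
    have h₁ := abs_le.1 (abs_translationValuation_concept (O := O) (F := F) A.size C)
    have h₂ := ABox.Admits.size_le h
    change _ ≤ (translationValuation O F D A.size).concept C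
    simp only [ObjName.depth]
    omega
  | bdia b ih | dia b ih =>
    have := ih h
    change _ ≤ (translationValuation O F D A.size).objName b + 1
    simp only [ObjName.depth]
    omega

theorem ABox.AdmitsFeat.translation {y : FeatName F D} (h : A.AdmitsFeat y) :
    (translationValuation O F D A.size).featName y ≤ 2 * A.size - y.depth := by
  induction y with
  | base b => change (A.size : ℤ) ≤ _; simp only [FeatName.depth]; omega
  | cls C =>
    have h₁ := abs_le.1 (abs_translationValuation_concept (O := O) (F := F) A.size C)
    have h₂ := ABox.Admits.size_le h
    change (translationValuation O F D A.size).concept C ≤ _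
    simp only [FeatName.depth]
    omega
  | box b ih | bbox b ih =>
    have := ih h
    change (translationValuation O F D A.size).featName b - 1 ≤ _
    simp only [FeatName.depth]
    omega

/-- Objects never drop below 1 and, dually, features never exceed 4, so a true incidence traps both
its names between 1 and 4. -/
theorem one_le_chainValuation_objName (b : ObjName O D) :
    1 ≤ (chainValuation O F D).objName b := by
  induction b with
  | base b => change (1 : Fin 6) ≤ 1; decide
  | cls C =>
    change 1 ≤ (chainValuation O F D).concept C
    rcases chainValuation_concept (O := O) (F := F) C with h | h <;> rw [h] <;> decide
  | bdia b ih =>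
    change 1 ≤ chainLattice.bdia ((chainValuation O F D).objName b)
    exact le_trans (by decide) (chainLattice.gc_box.monotone_l ih)
  | dia b ih =>
    change 1 ≤ chainLattice.dia ((chainValuation O F D).objName b)
    exact le_trans (by decide) (chainLattice.gc_dia.monotone_l ih)

theorem chainValuation_featName_le (y : FeatName F D) :
    (chainValuation O F D).featName y ≤ 4 := by
  induction y with
  | base b => change (4 : Fin 6) ≤ 4; decide
  | cls C =>
    change (chainValuation O F D).concept C ≤ 4
    rcases chainValuation_concept (O := O) (F := F) C with h | h <;> rw [h] <;> decide
  | box b ih =>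
    change chainLattice.box ((chainValuation O F D).featName b) ≤ 4
    exact le_trans (chainLattice.gc_box.monotone_u ih) (by decide)
  | bbox b ih =>
    change chainLattice.bbox ((chainValuation O F D).featName b) ≤ 4
    exact le_trans (chainLattice.gc_dia.monotone_u ih) (by decide)

/-- The bounds for object names in a tableau for `A`. -/
structure ABox.BoundsObj (A : ABox O F D) (b : ObjName O D) : Prop where
  admits : A.AdmitsObj b
  depth_le : b.depth ≤ 4 * A.size
  chain : (chainValuation O F D).objName b ≤ 4

/-- The bounds for feature names in a tableau for `A`. -/
structure ABox.BoundsFeat (A : ABox O F D) (y : FeatName F D) : Prop where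
  admits : A.AdmitsFeat y
  depth_le : y.depth ≤ 4 * A.size
  chain : 1 ≤ (chainValuation O F D).featName y

/-- The bounds for terms in a tableau for `A`. -/
structure ABox.BoundsTerm (A : ABox O F D) (t : Term (ObjName O D) (FeatName F D) D) : Prop where
  obj : ∀ b, t.obj? = some b → A.BoundsObj b
  feat : ∀ y, t.feat? = some y → A.BoundsFeat y
  concept : ∀ C, t.concept? = some C → A.Admits C

/-- Truth in the integers squeezes the depths of b and y into the gap between -2n and 2n, whence the
bound 4n. Truth in the chain keeps objects off level 5 and features off level 0. -/
theorem ABox.boundsTerm_of_holds {t : Term (ObjName O D) (FeatName F D) D}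
    (h : A.AdmitsTerm t) (h₁ : (translationValuation O F D A.size).Holds t)
    (h₂ : (chainValuation O F D).Holds t) : A.BoundsTerm t := by
  have hbox (x : ℤ) : (translationValuation O F D A.size).box x = x - 1 := rfl
  have hdia (x : ℤ) : (translationValuation O F D A.size).dia x = x + 1 := rfl
  have h4 : ∀ x : Fin 6, (chainValuation O F D).dia x ≤ 4 → x ≤ 4 := by
    simp only [chainValuation, chainLattice]; decide
  have h1 : ∀ x : Fin 6, 1 ≤ (chainValuation O F D).box x → 1 ≤ x := by
    simp only [chainValuation, chainLattice]; decide
  have key : (∀ b, t.obj? = some b → b.depth ≤ 4 * A.size ∧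
        (chainValuation O F D).objName b ≤ 4) ∧
      (∀ y, t.feat? = some y → y.depth ≤ 4 * A.size ∧
        1 ≤ (chainValuation O F D).featName y) := by
    cases t with
    | inc b y =>
      simp only [ABox.admitsTerm_inc] at h
      have hb := h.1.translation
      have hy := h.2.translation
      simp only [Valuation.Holds] at h₁ h₂
      simp only [Term.obj?, Term.feat?, Option.some.injEq, forall_eq']
      exact ⟨⟨by omega, h₂.trans (chainValuation_featName_le y)⟩, by omega,
        (one_le_chainValuation_objName b).trans h₂⟩
    | rbox b y =>
      simp only [ABox.admitsTerm_rbox] at h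
      have hb := h.1.translation
      have hy := h.2.translation
      simp only [Valuation.Holds, hbox] at h₁ h₂
      simp only [Term.obj?, Term.feat?, Option.some.injEq, forall_eq']
      exact ⟨⟨by omega, h₂.trans (chainValuation_featName_le y.box)⟩, by omega,
        h1 _ ((one_le_chainValuation_objName b).trans h₂)⟩
    | rdia y b =>
      simp only [ABox.admitsTerm_rdia] at h
      have hb := h.1.translation
      have hy := h.2.translation
      simp only [Valuation.Holds, hdia] at h₁ h₂
      simp only [Term.obj?, Term.feat?, Option.some.injEq, forall_eq']
      exact ⟨⟨by omega, h4 _ (h₂.trans (chainValuation_featName_le y))⟩, by omega,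
        (one_le_chainValuation_objName b.dia).trans h₂⟩
    | obj b C =>
      simp only [ABox.admitsTerm_obj] at h
      have hb := h.1.translation
      have hC := abs_le.1 (abs_translationValuation_concept (O := O) (F := F) A.size C)
      have hs := h.2.size_le
      simp only [Valuation.Holds] at h₁ h₂
      simp only [Term.obj?, Term.feat?, Option.some.injEq, forall_eq', reduceCtorEq,
        false_implies, implies_true, and_true]
      exact ⟨by omega, h₂.trans (chainValuation_featName_le (.cls C))⟩
    | feat y C =>
      simp only [ABox.admitsTerm_feat] at h
      have hy := h.1.translation
      have hC := abs_le.1 (abs_translationValuation_concept (O := O) (F := F) A.size C)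
      have hs := h.2.size_le
      simp only [Valuation.Holds] at h₁ h₂
      simp only [Term.obj?, Term.feat?, Option.some.injEq, forall_eq', reduceCtorEq,
        false_implies, implies_true, true_and]
      exact ⟨by omega, (one_le_chainValuation_objName (.cls C)).trans h₂⟩
  exact ⟨fun b hb => ⟨h.1 b hb, (key.1 b hb).1, (key.1 b hb).2⟩,
    fun y hy => ⟨h.2.1 y hy, (key.2 y hy).1, (key.2 y hy).2⟩, h.2.2⟩

/-- The valuations say nothing about negative assertions, but original names and names of concepts
meet the bounds without them. -/
theorem ABox.boundsTerm_of_flat {t : Term (ObjName O D) (FeatName F D) D}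
    (h : A.AdmitsTerm t) (h₁ : ∀ b, t.obj? = some b → b.depth = 0)
    (h₂ : ∀ y, t.feat? = some y → y.depth = 0) : A.BoundsTerm t := by
  refine ⟨fun b hb => ⟨h.1 b hb, by simp [h₁ b hb], ?_⟩,
    fun y hy => ⟨h.2.1 y hy, by simp [h₂ y hy], ?_⟩, h.2.2⟩
  · have := h₁ b hb
    cases b with
    | base b => change (1 : Fin 6) ≤ 4; decide
    | cls C => exact chainValuation_featName_le (.cls C)
    | _ => simp [ObjName.depth] at this
  · have := h₂ y hy
    cases y with
    | base b => change (1 : Fin 6) ≤ 4; decide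
    | cls C => exact one_le_chainValuation_objName (.cls C)
    | _ => simp [FeatName.depth] at this

/-- The invariants of the tableaux in a run. -/
structure ABox.Invariant (A : ABox O F D) (T : Tableau O F D) : Prop where
  admits : A.AdmitsTableau T
  boxValuation : A.boxValuation.HoldsPos T
  diaValuation : A.diaValuation.HoldsPos T
  translation : (translationValuation O F D A.size).HoldsPos T
  chain : (chainValuation O F D).HoldsPos T
  negFlat : NegFlat T

theorem ABox.invariant_toTab (A : ABox O F D) : A.Invariant A.toTab :=
  ⟨A.admitsTableau_toTab, A.boxValuation_holdsPos, A.diaValuation_holdsPos,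
    translationValuation_holdsPos A, chainValuation_holdsPos A, A.negFlat_toTab⟩

theorem ABox.Invariant.rule {E : LocalInverse O F} {T S : Tableau O F D} (h : A.Invariant T)
    (r : Rule E T S) : A.Invariant (S ++ T) :=
  ⟨(h.admits.rule h.boxValuation h.diaValuation r).append h.admits,
    (h.boxValuation.rule (A.boxValuation_holdsAxiom E) r).append h.boxValuation,
    (h.diaValuation.rule (A.diaValuation_holdsAxiom E) r).append h.diaValuation,
    (h.translation.rule (translationValuation_holdsAxiom _ E) r).append h.translation,
    (h.chain.rule (chainValuation_holdsAxiom E) r).append h.chain,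
    (h.negFlat.rule r).append h.negFlat⟩

theorem ABox.Invariant.boundsTerm {T : Tableau O F D} (h : A.Invariant T)
    {α : TabAssertion O F D} (hα : α ∈ T) : A.BoundsTerm α.term := by
  rcases α with t | t
  · exact boundsTerm_of_holds (h.admits _ hα) (h.translation t hα) (h.chain t hα)
  · exact boundsTerm_of_flat (h.admits _ hα) (h.negFlat t hα).1 (h.negFlat t hα).2

end

/-! ## The number of assertions -/

section

variable {O F D : Type}

theorem flatMapT_val {α β : Type} (f : α → Timed (List β)) (l : List α) :
    (flatMapT f l).val = l.flatMap fun a => (f a).val := by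
  induction l with
  | nil => rfl
  | cons a l ih => simp [flatMapT, ih]

theorem LEConcept.length_subT (C : LEConcept D) (l : List (LEConcept D)) :
    (C.subT l).val.length = C.size + l.length := by
  induction C generalizing l <;> simp_all [subT, size] <;> omega

theorem ABox.length_occursT_le (A : ABox O F D) : (occursT A.toTab).val.length ≤ A.size := by
  rw [occursT, flatMapT_val]
  induction A with
  | nil => simp [ABox.toTab]
  | cons α A ih =>
    simp only [ABox.toTab, ABox.size, List.map_cons, List.flatMap_cons, List.length_append,
      List.sum_cons] at ih ⊢
    refine add_le_add ?_ ih
    rcases α with t | t <;> cases t <;>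
      simp [Assertion.toTab, Term.map, Assertion.concept?, Term.concept?, Assertion.size,
        Term.size, LEConcept.length_subT] <;> omega

theorem ABox.length_le_size (A : ABox O F D) : A.length ≤ A.size := by
  have h : ∀ x ∈ A.map Assertion.size, 1 ≤ x := by
    intro x hx
    obtain ⟨α, -, rfl⟩ := List.mem_map.1 hx
    rcases α with t | t <;> cases t <;> simp [Assertion.size, Term.size]
  simpa [ABox.size] using List.card_nsmul_le_sum _ 1 h

/-- An admitted concept is determined by a prefix among at most n^2 paths and one of at most n
occurring concepts. -/
theorem ABox.exists_finset_admits (A : ABox O F D) :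
    ∃ s : Finset (LEConcept D), s.card ≤ A.size ^ 3 ∧ ∀ C, A.Admits C → C ∈ s := by
  classical
  set o := (occursT A.toTab).val.toFinset with ho
  have hmem (C) : C ∈ o ↔ Occurs A.toTab C := by simp [ho]
  have hcard : o.card ≤ A.size := (List.toFinset_card_le _).trans A.length_occursT_le
  set p := o.biUnion LEConcept.paths with hp
  have hpcard : p.card ≤ A.size * A.size := by
    refine (Finset.card_biUnion_le_card_mul _ _ A.size fun C hC => ?_).trans
      (Nat.mul_le_mul_right _ hcard)
    exact C.card_paths_le.trans (size_le_of_occurs ((hmem C).1 hC))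
  refine ⟨(p ×ˢ o).image fun x => x.2.prefixed x.1, ?_, fun C hC => ?_⟩
  · refine Finset.card_image_le.trans ?_
    rw [Finset.card_product]
    exact (Nat.mul_le_mul hpcard hcard).trans_eq (by ring)
  · obtain ⟨C', w, hC', ⟨C'', hC'', hw⟩, rfl⟩ := hC.exists_prefixed
    refine Finset.mem_image.2 ⟨(w, C'), Finset.mem_product.2 ⟨?_, (hmem _).2 hC'⟩, rfl⟩
    exact Finset.mem_biUnion.2 ⟨C'', (hmem _).2 hC'', hw⟩

/-! ### The shape of operator words on names -/

/-- The name without the modal operators that stand on it. -/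
def ObjName.core : ObjName O D → ObjName O D
  | .base b => .base b
  | .cls C => .cls C
  | .bdia b => b.core
  | .dia b => b.core

/-- At most one modal operator on a name. -/
def ObjName.optional : Option Bool → ObjName O D → ObjName O D
  | none, b => b
  | some true, b => .bdia b
  | some false, b => .dia b

/-- The name with operators `◆`, `◇`, `◆` on an optional operator. -/
def ObjName.build (k : Option Bool) (i j : ℕ) (e : Bool) (b : ObjName O D) : ObjName O D :=
  optional (if e then some true else none) (dia^[j] (bdia^[i] (optional k b)))

/-- The levels are the states of an automaton reading the operators from the inside: 1 admits none,
2 repeated ◆, 3 repeated ◇ on top, 4 one further ◆. The function h is left abstract so that the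
lemma also serves features, after reversal of the chain. -/
theorem ObjName.exists_build_of_chain (h : ObjName O D → Fin 6) (h₁ : ∀ b, 1 ≤ h b)
    (hb : ∀ b, h (.bdia b) = chainLattice.bdia (h b))
    (hd : ∀ b, h (.dia b) = chainLattice.dia (h b)) (b : ObjName O D) :
    (h b ≤ 1 → b = b.core) ∧
    (h b ≤ 2 → ∃ k, ∃ i ≤ b.depth, b = bdia^[i] (optional k b.core)) ∧
    (h b ≤ 3 → ∃ k, ∃ i ≤ b.depth, ∃ j ≤ b.depth,
      b = dia^[j] (bdia^[i] (optional k b.core))) ∧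
    (h b ≤ 4 → ∃ k, ∃ i ≤ b.depth, ∃ j ≤ b.depth, ∃ e, b = build k i j e b.core) := by
  -- These facts read the transition table backwards: from a bound on the level after an operator to
  -- a bound on the level before it.
  have b₁ : ∀ x, 1 ≤ x → ¬ chainLattice.bdia x ≤ 1 := by simp only [chainLattice]; decide
  have b₂ : ∀ x, chainLattice.bdia x ≤ 2 → x ≤ 2 := by simp only [chainLattice]; decide
  have b₃ : ∀ x, chainLattice.bdia x ≤ 3 → x ≤ 2 := by simp only [chainLattice]; decide
  have b₄ : ∀ x, chainLattice.bdia x ≤ 4 → x ≤ 3 := by simp only [chainLattice]; decide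
  have d₁ : ∀ x, 1 ≤ x → ¬ chainLattice.dia x ≤ 1 := by simp only [chainLattice]; decide
  have d₂ : ∀ x, chainLattice.dia x ≤ 2 → x ≤ 1 := by simp only [chainLattice]; decide
  have d₃ : ∀ x, chainLattice.dia x ≤ 3 → x ≤ 3 := by simp only [chainLattice]; decide
  have d₄ : ∀ x, chainLattice.dia x ≤ 4 → x ≤ 3 := by simp only [chainLattice]; decide
  induction b with
  | base b =>
    exact ⟨fun _ => rfl, fun _ => ⟨none, 0, le_rfl, rfl⟩, fun _ => ⟨none, 0, le_rfl, 0, le_rfl, rfl⟩,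
      fun _ => ⟨none, 0, le_rfl, 0, le_rfl, false, rfl⟩⟩
  | cls C =>
    exact ⟨fun _ => rfl, fun _ => ⟨none, 0, le_rfl, rfl⟩, fun _ => ⟨none, 0, le_rfl, 0, le_rfl, rfl⟩,
      fun _ => ⟨none, 0, le_rfl, 0, le_rfl, false, rfl⟩⟩
  | bdia b ih =>
    obtain ⟨-, ih₂, ih₃, -⟩ := ih
    have ih₂' (hb₂ : h b ≤ 2) : ∃ k, ∃ i ≤ b.bdia.depth,
        b.bdia = bdia^[i] (optional k b.bdia.core) := by
      obtain ⟨k, i, hi, e⟩ := ih₂ hb₂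
      refine ⟨k, i + 1, by simpa [depth] using hi, ?_⟩
      rw [Function.iterate_succ_apply']
      exact congrArg bdia e
    rw [hb]
    refine ⟨fun h' => absurd h' (b₁ _ (h₁ b)), fun h' => ih₂' (b₂ _ h'), fun h' => ?_,
      fun h' => ?_⟩
    · obtain ⟨k, i, hi, e⟩ := ih₂' (b₃ _ h')
      exact ⟨k, i, hi, 0, Nat.zero_le _, e⟩
    · obtain ⟨k, i, hi, j, hj, e⟩ := ih₃ (b₄ _ h')
      exact ⟨k, i, Nat.le_succ_of_le hi, j, Nat.le_succ_of_le hj, true, congrArg bdia e⟩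
  | dia b ih =>
    obtain ⟨ih₁, -, ih₃, -⟩ := ih
    have ih₃' (hb₃ : h b ≤ 3) : ∃ k, ∃ i ≤ b.dia.depth, ∃ j ≤ b.dia.depth,
        b.dia = dia^[j] (bdia^[i] (optional k b.dia.core)) := by
      obtain ⟨k, i, hi, j, hj, e⟩ := ih₃ hb₃
      refine ⟨k, i, Nat.le_succ_of_le hi, j + 1, by simpa [depth] using hj, ?_⟩
      rw [Function.iterate_succ_apply']
      exact congrArg dia e
    rw [hd]
    refine ⟨fun h' => absurd h' (d₁ _ (h₁ b)), fun h' => ?_, fun h' => ih₃' (d₃ _ h'),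
      fun h' => ?_⟩
    -- A ◇ that only reaches level 2 stands directly on the core; the optional innermost operator
    -- accounts for it.
    · exact ⟨some false, 0, Nat.zero_le _, congrArg dia (ih₁ (d₂ _ h'))⟩
    · obtain ⟨k, i, hi, j, hj, e⟩ := ih₃' (d₄ _ h')
      exact ⟨k, i, hi, j, hj, false, e⟩

/-- There are few names of bounded depth with the shape given by the six-element chain. -/
theorem ObjName.exists_finset (h : ObjName O D → Fin 6) (h₁ : ∀ b, 1 ≤ h b)
    (hb : ∀ b, h (.bdia b) = chainLattice.bdia (h b))
    (hd : ∀ b, h (.dia b) = chainLattice.dia (h b)) (B : List O) (s : Finset (LEConcept D))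
    (m : ℕ) : ∃ N : Finset (ObjName O D), N.card ≤ (B.length + s.card) * (6 * (m + 1) ^ 2) ∧
      ∀ b, h b ≤ 4 → b.depth ≤ m →
        ((∃ a ∈ B, b.core = .base a) ∨ ∃ C ∈ s, b.core = .cls C) → b ∈ N := by
  classical
  set K : Finset (ObjName O D) := (B.map .base).toFinset ∪ s.image .cls with hK
  have hKc : K.card ≤ B.length + s.card := by
    refine (Finset.card_union_le _ _).trans (add_le_add ?_ Finset.card_image_le)
    exact (List.toFinset_card_le _).trans_eq (by simp)
  set J : Finset (Option Bool × ℕ × ℕ × Bool) :=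
    Finset.univ ×ˢ Finset.range (m + 1) ×ˢ Finset.range (m + 1) ×ˢ Finset.univ with hJ
  -- Three choices for the innermost operator, two for the outermost, and m + 1 for each exponent.
  have hJc : J.card = 6 * (m + 1) ^ 2 := by
    simp only [hJ, Finset.card_product, Finset.card_univ, Finset.card_range, Fintype.card_option,
      Fintype.card_bool]
    ring
  refine ⟨(K ×ˢ J).image fun x => build x.2.1 x.2.2.1 x.2.2.2.1 x.2.2.2.2 x.1, ?_, ?_⟩
  · refine Finset.card_image_le.trans ?_
    rw [Finset.card_product, hJc]
    exact Nat.mul_le_mul_right _ hKc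
  · intro b hb₄ hm hcore
    obtain ⟨k, i, hi, j, hj, e, he⟩ := (exists_build_of_chain h h₁ hb hd b).2.2.2 hb₄
    refine Finset.mem_image.2 ⟨(b.core, k, i, j, e), ?_, he.symm⟩
    simp only [hJ, Finset.mem_product, Finset.mem_univ, Finset.mem_range, true_and, and_true]
    refine ⟨?_, by omega, by omega⟩
    rw [hK, Finset.mem_union, List.mem_toFinset, List.mem_map, Finset.mem_image]
    rcases hcore with ⟨a, ha, h⟩ | ⟨C, hC, h⟩
    exacts [.inl ⟨a, ha, h.symm⟩, .inr ⟨C, hC, h.symm⟩]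

/-- Feature names as object names, with `□`, `■` read as `◇`, `◆`. -/
def FeatName.toObj : FeatName F D → ObjName F D
  | .base y => .base y
  | .cls C => .cls C
  | .box y => .dia y.toObj
  | .bbox y => .bdia y.toObj

/-- Object names as feature names, with `◇`, `◆` read as `□`, `■`. -/
def FeatName.ofObj : ObjName F D → FeatName F D
  | .base y => .base y
  | .cls C => .cls C
  | .dia y => .box (ofObj y)
  | .bdia y => .bbox (ofObj y)

@[simp] theorem FeatName.ofObj_toObj (y : FeatName F D) : ofObj y.toObj = y := by
  induction y <;> simp_all [ofObj, toObj]

theorem FeatName.depth_toObj (y : FeatName F D) : y.toObj.depth = y.depth := by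
  induction y <;> simp_all [toObj, depth, ObjName.depth]

variable {A : ABox O F D}

theorem ABox.AdmitsObj.core {b : ObjName O D} (h : A.AdmitsObj b) {s : Finset (LEConcept D)}
    (hs : ∀ C, A.Admits C → C ∈ s) :
    (∃ a ∈ A.objs, b.core = .base a) ∨ ∃ C ∈ s, b.core = .cls C := by
  induction b with
  | base b => exact .inl ⟨b, h, rfl⟩
  | cls C => exact .inr ⟨C, hs C h, rfl⟩
  | bdia b ih => exact ih h
  | dia b ih => exact ih h

theorem ABox.AdmitsFeat.core {y : FeatName F D} (h : A.AdmitsFeat y) {s : Finset (LEConcept D)}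
    (hs : ∀ C, A.Admits C → C ∈ s) :
    (∃ a ∈ A.feats, y.toObj.core = .base a) ∨ ∃ C ∈ s, y.toObj.core = .cls C := by
  induction y with
  | base b => exact .inl ⟨b, h, rfl⟩
  | cls C => exact .inr ⟨C, hs C h, rfl⟩
  | box b ih => exact ih h
  | bbox b ih => exact ih h

end

/-- A bound for the number of names in a tableau, for an ABox of size `n`. -/
def nameBound {R : Type*} [CommSemiring R] (n : R) : R :=
  (n + n ^ 3) * (6 * (4 * n + 1) ^ 2)

/-- A bound for the number of assertions in a tableau, for an ABox of size `n`. -/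
def assertionBound {R : Type*} [CommSemiring R] (n : R) : R :=
  2 * (3 * nameBound n ^ 2 + 2 * (nameBound n * n ^ 3))

section

variable {O F D : Type} (A : ABox O F D)

theorem ABox.exists_finset_boundsObj :
    ∃ N : Finset (ObjName O D), N.card ≤ nameBound A.size ∧ ∀ b, A.BoundsObj b → b ∈ N := by
  obtain ⟨s, hs, hsA⟩ := A.exists_finset_admits
  obtain ⟨N, hN, h⟩ := ObjName.exists_finset ((chainValuation O F D).objName)
    one_le_chainValuation_objName
    (fun _ => rfl) (fun _ => rfl) A.objs s (4 * A.size)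
  refine ⟨N, hN.trans (Nat.mul_le_mul_right _ (add_le_add ?_ hs)),
    fun b hb => h b hb.chain hb.depth_le (hb.admits.core hsA)⟩
  exact (List.length_filterMap_le _ _).trans A.length_le_size

/-- Features are objects upside down: reading □, ■ as ◇, ◆ and reversing the chain turns the lower
bound 1 into the upper bound 4, so the count for objects applies. -/
theorem ABox.exists_finset_boundsFeat :
    ∃ N : Finset (FeatName F D), N.card ≤ nameBound A.size ∧ ∀ y, A.BoundsFeat y → y ∈ N := by
  classical
  obtain ⟨s, hs, hsA⟩ := A.exists_finset_admits
  obtain ⟨N, hN, h⟩ := ObjName.exists_finset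
    (fun y => ((chainValuation O F D).featName (FeatName.ofObj y)).rev)
    (fun y => by
      have : ∀ x : Fin 6, x ≤ 4 → 1 ≤ x.rev := by decide
      exact this _ (chainValuation_featName_le _))
    (fun y => by
      have : ∀ x : Fin 6, (chainLattice.bbox x).rev = chainLattice.bdia x.rev := by
        simp only [chainLattice]; decide
      exact this _)
    (fun y => by
      have : ∀ x : Fin 6, (chainLattice.box x).rev = chainLattice.dia x.rev := by
        simp only [chainLattice]; decide
      exact this _) A.feats s (4 * A.size)
  refine ⟨N.image FeatName.ofObj, Finset.card_image_le.trans
    (hN.trans (Nat.mul_le_mul_right _ (add_le_add ?_ hs))), fun y hy => ?_⟩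
  · exact (List.length_filterMap_le _ _).trans A.length_le_size
  · refine Finset.mem_image.2 ⟨y.toObj, h _ ?_ ?_ (hy.admits.core hsA), y.ofObj_toObj⟩
    · have : ∀ x : Fin 6, 1 ≤ x → x.rev ≤ 4 := by decide
      rw [FeatName.ofObj_toObj]
      exact this _ hy.chain
    · rw [FeatName.depth_toObj]
      exact hy.depth_le

theorem ABox.exists_finset_boundsTerm :
    ∃ N : Finset (TabAssertion O F D), N.card ≤ assertionBound A.size ∧
      ∀ α : TabAssertion O F D, A.BoundsTerm α.term → α ∈ N := by
  classical
  obtain ⟨s, hs, hsA⟩ := A.exists_finset_admits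
  obtain ⟨N, hN, hNA⟩ := A.exists_finset_boundsObj
  obtain ⟨M, hM, hMA⟩ := A.exists_finset_boundsFeat
  set t : Finset (Term (ObjName O D) (FeatName F D) D) :=
    (N ×ˢ M).image (fun x => .inc x.1 x.2) ∪ ((N ×ˢ M).image (fun x => .rbox x.1 x.2) ∪
      ((N ×ˢ M).image (fun x => .rdia x.2 x.1) ∪ ((N ×ˢ s).image (fun x => .obj x.1 x.2) ∪
        (M ×ˢ s).image (fun x => .feat x.1 x.2)))) with ht
  have htc : t.card ≤ 3 * nameBound A.size ^ 2 + 2 * (nameBound A.size * A.size ^ 3) := by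
    have h₁ : (N ×ˢ M).card ≤ nameBound A.size ^ 2 := by
      rw [Finset.card_product, sq]; exact Nat.mul_le_mul hN hM
    have h₂ : (N ×ˢ s).card ≤ nameBound A.size * A.size ^ 3 := by
      rw [Finset.card_product]; exact Nat.mul_le_mul hN hs
    have h₃ : (M ×ˢ s).card ≤ nameBound A.size * A.size ^ 3 := by
      rw [Finset.card_product]; exact Nat.mul_le_mul hM hs
    refine (Finset.card_union_le _ _).trans ((add_le_add (Finset.card_image_le.trans h₁)
      ((Finset.card_union_le _ _).trans (add_le_add (Finset.card_image_le.trans h₁)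
      ((Finset.card_union_le _ _).trans (add_le_add (Finset.card_image_le.trans h₁)
      ((Finset.card_union_le _ _).trans (add_le_add (Finset.card_image_le.trans h₂)
        (Finset.card_image_le.trans h₃)))))))).trans ?_)
    omega
  have hmem (u : Term (ObjName O D) (FeatName F D) D) (h : A.BoundsTerm u) : u ∈ t := by
    cases u with
    | inc b y => simp [ht, hNA b (h.obj b rfl), hMA y (h.feat y rfl)]
    | rbox b y => simp [ht, hNA b (h.obj b rfl), hMA y (h.feat y rfl)]
    | rdia y b => simp [ht, hNA b (h.obj b rfl), hMA y (h.feat y rfl)]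
    | obj b C => simp [ht, hNA b (h.obj b rfl), hsA C (h.concept C rfl)]
    | feat y C => simp [ht, hMA y (h.feat y rfl), hsA C (h.concept C rfl)]
  refine ⟨t.image .pos ∪ t.image .neg, ?_, fun α h => ?_⟩
  · refine (Finset.card_union_le _ _).trans ((add_le_add Finset.card_image_le
      Finset.card_image_le).trans ?_)
    rw [assertionBound]
    omega
  · rcases α with u | u
    · exact Finset.mem_union_left _ (Finset.mem_image_of_mem _ (hmem u h))
    · exact Finset.mem_union_right _ (Finset.mem_image_of_mem _ (hmem u h))

end

open Timed

/-! ## The cost of a round -/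

namespace Timed

@[simp] theorem cost_pure {α : Type} (a : α) : (pure a : Timed α).cost = 0 := rfl

@[simp] theorem cost_bind {α β : Type} (x : Timed α) (f : α → Timed β) :
    (x >>= f).cost = x.cost + (f x.val).cost := rfl

@[simp] theorem cost_tick : tick.cost = 1 := rfl

@[simp] theorem cost_ite {α : Type} (c : Prop) [Decidable c] (x y : Timed α) :
    (if c then x else y).cost = if c then x.cost else y.cost := by
  split <;> rfl

end Timed

section

variable {α β : Type}

theorem appendT_cost (k l : List α) : (appendT k l).cost = k.length + 1 := by
  induction k with
  | nil => rfl
  | cons a k ih => simp [appendT, ih]; omega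

theorem flatMapT_cost_le {f : α → Timed (List β)} {l : List α} {c k : ℕ}
    (hc : ∀ a ∈ l, (f a).cost ≤ c) (hk : ∀ a ∈ l, (f a).val.length ≤ k) :
    (flatMapT f l).cost ≤ l.length * (c + k + 2) + 1 := by
  induction l with
  | nil => simp [flatMapT]
  | cons a l ih =>
    have ih := ih (fun a ha => hc a (List.mem_cons_of_mem _ ha))
      (fun a ha => hk a (List.mem_cons_of_mem _ ha))
    have h₁ := hc a List.mem_cons_self
    have h₂ := hk a List.mem_cons_self
    simp only [flatMapT, Timed.cost_bind, Timed.cost_tick, appendT_cost, List.length_cons,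
      add_mul]
    omega

theorem flatMapT_length_le {f : α → Timed (List β)} {l : List α} {k : ℕ}
    (hk : ∀ a ∈ l, (f a).val.length ≤ k) : (flatMapT f l).val.length ≤ l.length * k := by
  induction l with
  | nil => simp [flatMapT]
  | cons a l ih =>
    have ih := ih (fun a ha => hk a (List.mem_cons_of_mem _ ha))
    have h₂ := hk a List.mem_cons_self
    simp only [flatMapT, Timed.val_bind, appendT_val, List.length_append, List.length_cons,
      add_mul]
    omega

theorem filterT_cost_le {f : α → Timed Bool} {l : List α} {c : ℕ}
    (hc : ∀ a ∈ l, (f a).cost ≤ c) : (filterT f l).cost ≤ l.length * (c + 1) + 1 := by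
  induction l with
  | nil => simp [filterT]
  | cons a l ih =>
    have ih := ih (fun a ha => hc a (List.mem_cons_of_mem _ ha))
    have h₁ := hc a List.mem_cons_self
    simp only [filterT, Timed.cost_bind, Timed.cost_tick, Timed.cost_ite, Timed.cost_pure,
      List.length_cons, add_mul]
    split <;> omega

theorem anyT_cost_le {f : α → Timed Bool} {l : List α} {c : ℕ}
    (hc : ∀ a ∈ l, (f a).cost ≤ c) : (anyT f l).cost ≤ l.length * (c + 1) + 1 := by
  induction l with
  | nil => simp [anyT]
  | cons a l ih =>
    have ih := ih (fun a ha => hc a (List.mem_cons_of_mem _ ha))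
    have h₁ := hc a List.mem_cons_self
    simp only [anyT, Timed.cost_bind, Timed.cost_tick, Timed.cost_ite, Timed.cost_pure,
      List.length_cons, add_mul]
    split <;> omega

end

/-! ### Node counts and the cost of single tests -/

section

variable {O F D : Type}

/-- The number of nodes of an object name. -/
def ObjName.nodes : ObjName O D → ℕ
  | .base _ => 1
  | .cls C => C.size + 1
  | .bdia b => b.nodes + 1
  | .dia b => b.nodes + 1

/-- The number of nodes of a feature name. -/
def FeatName.nodes : FeatName F D → ℕ
  | .base _ => 1
  | .cls C => C.size + 1
  | .box y => y.nodes + 1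
  | .bbox y => y.nodes + 1

/-- The number of nodes of a term. -/
def Term.nodes : Term (ObjName O D) (FeatName F D) D → ℕ
  | .inc b y => b.nodes + y.nodes + 1
  | .rbox b y => b.nodes + y.nodes + 1
  | .rdia y b => b.nodes + y.nodes + 1
  | .obj b C => b.nodes + C.size + 1
  | .feat y C => y.nodes + C.size + 1

/-- The number of nodes of an assertion. -/
def Assertion.nodes (α : TabAssertion O F D) : ℕ := α.term.nodes + 1

theorem ABox.AdmitsObj.nodes_le {A : ABox O F D} {b : ObjName O D} (h : A.AdmitsObj b) :
    b.nodes ≤ 2 * A.size + 1 + b.depth := by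
  induction b with
  | base b => simp only [ObjName.nodes]; omega
  | cls C => have := ABox.Admits.size_le h; simp only [ObjName.nodes]; omega
  | bdia b ih | dia b ih => have := ih h; simp only [ObjName.nodes, ObjName.depth]; omega

theorem ABox.AdmitsFeat.nodes_le {A : ABox O F D} {y : FeatName F D} (h : A.AdmitsFeat y) :
    y.nodes ≤ 2 * A.size + 1 + y.depth := by
  induction y with
  | base b => simp only [FeatName.nodes]; omega
  | cls C => have := ABox.Admits.size_le h; simp only [FeatName.nodes]; omega
  | box b ih | bbox b ih => have := ih h; simp only [FeatName.nodes, FeatName.depth]; omega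

/-- A name has at most 2n + 1 nodes in its core and 4n operators; two names and two constructors
give 12n + 4. -/
theorem ABox.BoundsTerm.nodes_le {A : ABox O F D} {α : TabAssertion O F D}
    (h : A.BoundsTerm α.term) : α.nodes ≤ 12 * A.size + 4 := by
  have hb (b) (h' : α.term.obj? = some b) : b.nodes ≤ 6 * A.size + 1 := by
    have h₁ := (h.obj b h').admits.nodes_le
    have h₂ := (h.obj b h').depth_le
    omega
  have hy (y) (h' : α.term.feat? = some y) : y.nodes ≤ 6 * A.size + 1 := by
    have h₁ := (h.feat y h').admits.nodes_le
    have h₂ := (h.feat y h').depth_le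
    omega
  have hC (C) (h' : α.term.concept? = some C) : C.size ≤ 2 * A.size := (h.concept C h').size_le
  unfold Assertion.nodes
  generalize α.term = t at hb hy hC
  cases t with
  | inc b y | rbox b y | rdia y b =>
    have := hb b rfl
    have := hy y rfl
    simp only [Term.nodes]
    omega
  | obj b C =>
    have := hb b rfl
    have := hC C rfl
    simp only [Term.nodes]
    omega
  | feat y C =>
    have := hy y rfl
    have := hC C rfl
    simp only [Term.nodes]
    omega

theorem LEConcept.subT_cost (C : LEConcept D) (l : List (LEConcept D)) :
    (C.subT l).cost = C.size := by
  induction C generalizing l <;> simp_all [subT, size] <;> omega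

theorem Assertion.size_le_nodes {α : TabAssertion O F D} {C : LEConcept D}
    (h : α.concept? = some C) : C.size ≤ α.nodes := by
  rcases α with t | t <;> cases t <;>
    simp_all [Assertion.concept?, Term.concept?, Assertion.nodes, Term.nodes, Assertion.term] <;>
    omega

theorem Rule.length_le {E : LocalInverse O F} {T S : Tableau O F D} (r : Rule E T S) :
    S.length ≤ 2 := by
  cases r <;> simp

theorem length_incFeat_le (b : ObjName O D) (y : FeatName F D) : (incFeat b y).length ≤ 2 := by
  unfold incFeat; split <;> simp

theorem length_incObj_le (y : FeatName F D) (b : ObjName O D) : (incObj y b).length ≤ 2 := by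
  unfold incObj; split <;> simp

theorem length_ruleSA_le [DecidableEq O] (y : FeatName F D) (E : LocalInverse O F)
    (b : ObjName O D) : (ruleSA y E b).length ≤ 1 := by
  unfold ruleSA; split
  · split <;> simp
  · simp

theorem length_ruleSX_le [DecidableEq F] (b : ObjName O D) (E : LocalInverse O F)
    (y : FeatName F D) : (ruleSX b E y).length ≤ 1 := by
  unfold ruleSX; split
  · split <;> simp
  · simp

theorem guardT_cost (t : Timed Bool) (S : Tableau O F D) : (guardT t S).cost = t.cost := by
  simp [guardT]

theorem length_guardT_le (t : Timed Bool) (S : Tableau O F D) :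
    (guardT t S).val.length ≤ 1 := by
  simp only [guardT, Timed.val_bind, Timed.val_ite, Timed.val_pure]
  split <;> simp

theorem oneT_bounds [DecidableEq O] [DecidableEq F] (E : LocalInverse O F)
    (α : TabAssertion O F D) : (oneT E α).cost ≤ 4 ∧ (oneT E α).val.length ≤ 4 := by
  simp only [oneT, Timed.cost_bind, Timed.val_bind, Timed.cost_tick]
  split
  · rename_i b y
    have h₁ := length_incFeat_le b y
    have h₂ := length_incObj_le y b
    simp only [appendT_cost, appendT_val, List.length_append]
    omega
  · rename_i b y
    have := length_ruleSA_le y E b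
    simp only [Timed.cost_pure, Timed.val_pure, List.length_cons]
    omega
  · rename_i b y
    have := length_ruleSX_le y E b
    simp only [Timed.cost_pure, Timed.val_pure, List.length_cons]
    omega
  all_goals simp

theorem occursT_cost_le {T : Tableau O F D} {s : ℕ} (hs : ∀ β ∈ T, β.nodes ≤ s) :
    (occursT T).cost ≤ T.length * (1 + s + s + 2) + 1 ∧
      (occursT T).val.length ≤ T.length * s := by
  refine ⟨flatMapT_cost_le (fun α hα => ?_) (fun α hα => ?_),
    flatMapT_length_le (fun α hα => ?_)⟩ <;>
  · have := hs α hα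
    simp only [Timed.cost_bind, Timed.val_bind, Timed.cost_tick]
    split
    · rename_i C hC
      have := Assertion.size_le_nodes hC
      simp only [LEConcept.subT_cost, LEConcept.length_subT, List.length_nil]
      omega
    · simp

/-- The test descends both arguments in parallel. Bounding it by the second one alone suffices, and
later allows membership tests for assertions of unknown size. -/
theorem LEConcept.eqT_cost_le [DecidableEq D] (C C' : LEConcept D) : (C.eqT C').cost ≤ C'.size := by
  induction C generalizing C' with
  | atom d => cases C' <;> simp [eqT, size]
  | and C₁ C₂ h₁ h₂ | or C₁ C₂ h₁ h₂ =>
    cases C' with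
    | and B₁ B₂ | or B₁ B₂ =>
      have := h₁ B₁
      have := h₂ B₂
      simp only [eqT, size, Timed.cost_bind, Timed.cost_tick, Timed.cost_ite, Timed.cost_pure]
      first
        | omega
        | split <;> omega
    | _ => simp [eqT, size]
  | box C h | dia C h =>
    cases C' with
    | box B | dia B =>
      have := h B
      simp only [eqT, size, Timed.cost_bind, Timed.cost_tick, Timed.cost_pure]
      omega
    | _ => simp [eqT, size]

theorem ruleBoxT_bounds [DecidableEq D] (b : ObjName O D) (y : FeatName F D) (C' C : LEConcept D) :
    (ruleBoxT b y C' C).cost ≤ C'.size ∧ (ruleBoxT b y C' C).val.length ≤ 1 := by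
  unfold ruleBoxT
  split
  · rw [guardT_cost]
    exact ⟨LEConcept.eqT_cost_le _ _, length_guardT_le _ _⟩
  · simp

theorem ruleDiaT_bounds [DecidableEq D] (b : ObjName O D) (y : FeatName F D) (C C' : LEConcept D) :
    (ruleDiaT b y C C').cost ≤ C.size ∧ (ruleDiaT b y C C').val.length ≤ 1 := by
  unfold ruleDiaT
  split
  · rw [guardT_cost]
    exact ⟨LEConcept.eqT_cost_le _ _, length_guardT_le _ _⟩
  · simp

theorem twoT_bounds [DecidableEq D] {s : ℕ} {α β : TabAssertion O F D} (hα : α.nodes ≤ s) (hβ : β.nodes ≤ s) :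
    (twoT α β).cost ≤ 3 * s + 6 ∧ (twoT α β).val.length ≤ 3 := by
  simp only [twoT, Timed.cost_bind, Timed.val_bind, Timed.cost_tick]
  split
  · rename_i b C y C'
    have h₁ := Assertion.size_le_nodes (α := .pos (.obj b C)) (F := F) rfl
    have h₂ := Assertion.size_le_nodes (α := .pos (.feat y C')) (O := O) rfl
    have h₃ := ruleBoxT_bounds b y C' C
    have h₄ := ruleDiaT_bounds b y C C'
    have h₅ := C.eqT_cost_le C'
    have h₆ := length_guardT_le (C.eqT C') [.pos (.inc b y)]
    simp only [Timed.cost_bind, Timed.val_bind, guardT_cost, appendT_cost, appendT_val,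
      List.length_append]
    omega
  · simp

variable [DecidableEq O] [DecidableEq F] [DecidableEq D]

theorem ObjName.eqT_cost_le (b b' : ObjName O D) : (b.eqT b').cost ≤ b'.nodes := by
  induction b generalizing b' with
  | base b => cases b' <;> simp [eqT, nodes]
  | cls C =>
    cases b' with
    | cls C' =>
      have := C.eqT_cost_le C'
      simp only [eqT, nodes, Timed.cost_bind, Timed.cost_tick]
      omega
    | _ => simp [eqT, nodes]
  | bdia b h | dia b h =>
    cases b' with
    | bdia b' | dia b' =>
      have := h b'
      simp only [eqT, nodes, Timed.cost_bind, Timed.cost_tick, Timed.cost_pure]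
      omega
    | _ => simp [eqT, nodes]

theorem FeatName.eqT_cost_le (y y' : FeatName F D) : (y.eqT y').cost ≤ y'.nodes := by
  induction y generalizing y' with
  | base b => cases y' <;> simp [eqT, nodes]
  | cls C =>
    cases y' with
    | cls C' =>
      have := C.eqT_cost_le C'
      simp only [eqT, nodes, Timed.cost_bind, Timed.cost_tick]
      omega
    | _ => simp [eqT, nodes]
  | box b h | bbox b h =>
    cases y' with
    | box b' | bbox b' =>
      have := h b'
      simp only [eqT, nodes, Timed.cost_bind, Timed.cost_tick, Timed.cost_pure]
      omega
    | _ => simp [eqT, nodes]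

theorem Term.eqT_cost_le (t t' : Term (ObjName O D) (FeatName F D) D) :
    (t.eqT t').cost ≤ t'.nodes := by
  cases t <;> cases t' <;>
    simp only [eqT, nodes, Timed.cost_bind, Timed.cost_tick, Timed.cost_ite, Timed.cost_pure] <;>
    first
    | omega
    | (rename_i b y b' y'
       first
       | (have h₁ := ObjName.eqT_cost_le b b'
          have h₂ := FeatName.eqT_cost_le y y'
          split <;> omega)
       | (have h₁ := ObjName.eqT_cost_le y y'
          have h₂ := FeatName.eqT_cost_le b b'
          split <;> omega)
       | (have h₁ := ObjName.eqT_cost_le b b'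
          have h₂ := LEConcept.eqT_cost_le y y'
          split <;> omega)
       | (have h₁ := FeatName.eqT_cost_le b b'
          have h₂ := LEConcept.eqT_cost_le y y'
          split <;> omega))

theorem Assertion.eqT_cost_le (α β : TabAssertion O F D) : (α.eqT β).cost ≤ β.nodes := by
  rcases α with t | t <;> rcases β with t' | t' <;>
    simp only [eqT, nodes, term, Timed.cost_bind, Timed.cost_tick, Timed.cost_pure]
  · have := t.eqT_cost_le t'; omega
  · omega
  · omega
  · have := t.eqT_cost_le t'; omega

end

/-- A bound for the cost of a round, for a tableau with `N` assertions of at most `s` nodes. -/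
def roundBound {R : Type*} [CommSemiring R] (N s : R) : R :=
  let mem := N * (s + 1) + 1
  let clash := N * (1 + mem + 1) + 1
  let occ := N * (1 + s + s + 2) + 1
  let r₁ := N * s * (1 + 1 + 2) + 1
  let r₂ := N * (4 + 4 + 2) + 1
  let r₃ := N * (N * (3 * s + 6 + 3 + 2) + 1 + N * 3 + 2) + 1
  let r₄ := N * s * (N * (1 + s + mem + 1 + 2) + 1 + N * 1 + 2) + 1
  let k := N * s * 1 + (N * 4 + (N * (N * 3) + N * s * (N * 1)))
  clash + (occ + (r₁ + (r₂ + (r₃ + (r₄ + (N * (N * 3) + 1 + (N * 4 + 1 + (N * s * 1 + 1 +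
    (k * (2 * (mem + 1) + 1 + 1) + 1)))))))))

section

variable {O F D : Type} [DecidableEq O] [DecidableEq F] [DecidableEq D]
  {T : Tableau O F D} {s : ℕ}

/-- No bound on α is needed, since each comparison is paid for by the entry of T; candidate
conclusions can thus be tested before their size is known. -/
theorem memT_cost_le (hs : ∀ β ∈ T, β.nodes ≤ s) (α : TabAssertion O F D) :
    (memT α T).cost ≤ T.length * (s + 1) + 1 :=
  anyT_cost_le fun β hβ => (α.eqT_cost_le β).trans (hs β hβ)

theorem clashT_cost_le (hs : ∀ β ∈ T, β.nodes ≤ s) :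
    (clashT T).cost ≤ T.length * (1 + (T.length * (s + 1) + 1) + 1) + 1 := by
  refine anyT_cost_le fun α _ => ?_
  simp only [Timed.cost_bind, Timed.cost_tick]
  refine Nat.add_le_add_left ?_ _
  split
  · exact memT_cost_le hs _
  · exact memT_cost_le hs _
  · exact memT_cost_le hs _
  · simp

theorem newT_cost_le (hs : ∀ β ∈ T, β.nodes ≤ s) {S : Tableau O F D} (hS : S.length ≤ 2) :
    (newT T S).cost ≤ 2 * (T.length * (s + 1) + 1 + 1) + 1 := by
  refine (anyT_cost_le (c := T.length * (s + 1) + 1) fun α _ => ?_).trans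
    (Nat.add_le_add_right (Nat.mul_le_mul_right _ hS) _)
  simpa using memT_cost_le hs α

theorem introT_bounds (hs : ∀ β ∈ T, β.nodes ≤ s) (C : LEConcept D) {α : TabAssertion O F D}
    (hα : α ∈ T) : (introT T C α).cost ≤ 1 + s + (T.length * (s + 1) + 1) ∧
      (introT T C α).val.length ≤ 1 := by
  have hα := hs α hα
  simp only [introT, Timed.cost_bind, Timed.val_bind, Timed.cost_tick]
  split
  · rename_i C₁ C₂ b B _
    have h₁ := Assertion.size_le_nodes (α := .pos (.obj b B)) (F := F) rfl
    have h₂ := C₁.eqT_cost_le B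
    have h₃ := memT_cost_le hs (.pos (.obj b C₂))
    refine ⟨?_, length_guardT_le _ _⟩
    simp only [guardT_cost, Timed.cost_bind, Timed.cost_ite, Timed.cost_pure]
    split <;> omega
  · rename_i C₁ C₂ y B _
    have h₁ := Assertion.size_le_nodes (α := .pos (.feat y B)) (O := O) rfl
    have h₂ := C₁.eqT_cost_le B
    have h₃ := memT_cost_le hs (.pos (.feat y C₂))
    refine ⟨?_, length_guardT_le _ _⟩
    simp only [guardT_cost, Timed.cost_bind, Timed.cost_ite, Timed.cost_pure]
    split <;> omega
  · simp only [Timed.cost_pure, Timed.val_pure, List.length_nil]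
    omega

/-- All candidates of the search have at most two conclusions. -/
theorem candidate_length_le (E : LocalInverse O F) {S : Tableau O F D}
    (hS : S ∈ (flatMapT (fun C => (do
        tick
        return [[.pos (.obj (.cls C) C), .pos (.feat (.cls C) C)]] :
          Timed (List (Tableau O F D)))) (occursT T).val).val ++
      ((flatMapT (fun α => oneT E α) T).val ++
        ((flatMapT (fun α => flatMapT (fun β => twoT α β) T) T).val ++
          (flatMapT (fun C => flatMapT (fun α => introT T C α) T) (occursT T).val).val))) :
    S.length ≤ 2 := by
  simp only [List.mem_append, mem_flatMapT, mem_occursT] at hS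
  rcases hS with ⟨C, hC, h⟩ | ⟨α, hα, h⟩ | ⟨α, hα, β, hβ, h⟩ | ⟨C, hC, α, hα, h⟩
  · simp only [Timed.val_bind, Timed.val_pure, List.mem_singleton] at h
    simp [h]
  · exact (rule_of_mem_oneT hα h).length_le
  · exact (rule_of_mem_twoT (E := E) hα hβ h).length_le
  · exact (rule_of_mem_introT (E := E) hC hα h).length_le

theorem roundT_cost_le (E : LocalInverse O F) (hs : ∀ β ∈ T, β.nodes ≤ s) :
    (roundT E T).cost ≤ roundBound T.length s := by
  have hclash := clashT_cost_le hs
  obtain ⟨hocc, hlen⟩ := occursT_cost_le hs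
  set l := (occursT T).val with hl
  have hr₁ := flatMapT_cost_le (c := 1) (k := 1) (l := l) (f := fun C => (do
    tick
    return [[.pos (.obj (.cls C) C), .pos (.feat (.cls C) C)]] : Timed (List (Tableau O F D))))
    (by simp) (by simp)
  have hk₁ := flatMapT_length_le (k := 1) (l := l) (f := fun C => (do
    tick
    return [[.pos (.obj (.cls C) C), .pos (.feat (.cls C) C)]] : Timed (List (Tableau O F D))))
    (by simp)
  have hr₂ := flatMapT_cost_le (l := T) (fun α _ => (oneT_bounds E α).1)
    (fun α _ => (oneT_bounds E α).2)
  have hk₂ := flatMapT_length_le (l := T) (fun α _ => (oneT_bounds E α).2)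
  have hk₃' (α) (hα : α ∈ T) := flatMapT_length_le (l := T)
    (fun β hβ => (twoT_bounds (hs α hα) (hs β hβ)).2)
  have hr₃ := flatMapT_cost_le (l := T) (fun α hα => flatMapT_cost_le (l := T)
    (fun β hβ => (twoT_bounds (hs α hα) (hs β hβ)).1)
    (fun β hβ => (twoT_bounds (hs α hα) (hs β hβ)).2)) hk₃'
  have hk₃ := flatMapT_length_le (l := T) hk₃'
  have hk₄' (C) (_ : C ∈ l) := flatMapT_length_le (l := T)
    (fun α hα => (introT_bounds hs C hα).2)
  have hr₄ := flatMapT_cost_le (l := l) (fun C _ => flatMapT_cost_le (l := T)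
    (fun α hα => (introT_bounds hs C hα).1) (fun α hα => (introT_bounds hs C hα).2)) hk₄'
  have hk₄ := flatMapT_length_le (l := l) hk₄'
  -- The two loops over occurring concepts are converted from the length of that list to its bound N
  -- · s.
  have hr₁ := hr₁.trans (Nat.add_le_add_right (Nat.mul_le_mul_right _ hlen) _)
  have hk₁ := hk₁.trans (Nat.mul_le_mul_right _ hlen)
  have hr₄ := hr₄.trans (Nat.add_le_add_right (Nat.mul_le_mul_right _ hlen) _)
  have hk₄ := hk₄.trans (Nat.mul_le_mul_right _ hlen)
  rw [roundT]
  simp only [Timed.cost_bind, Timed.cost_ite, Timed.cost_pure]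
  refine Nat.add_le_add hclash ?_
  split
  · exact Nat.zero_le _
  simp only [searchT, Timed.cost_bind, appendT_cost, appendT_val, add_zero]
  refine Nat.add_le_add hocc (Nat.add_le_add hr₁ (Nat.add_le_add hr₂ (Nat.add_le_add hr₃
    (Nat.add_le_add hr₄ (Nat.add_le_add (Nat.add_le_add_right hk₃ _)
    (Nat.add_le_add (Nat.add_le_add_right hk₂ _) (Nat.add_le_add (Nat.add_le_add_right hk₁ _)
    ((filterT_cost_le fun S hS => newT_cost_le hs (candidate_length_le E hS)).trans
      (Nat.add_le_add_right (Nat.mul_le_mul_right _ ?_) _)))))))))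
  simp only [List.length_append]
  exact add_le_add hk₁ (add_le_add hk₂ (add_le_add hk₃ hk₄))

end

/-! ## Runs of the algorithm -/

section

variable {O F D : Type} {E : LocalInverse O F} {A : ABox O F D}

open Classical in
theorem ABox.Invariant.card_le {T : Tableau O F D} (h : A.Invariant T) :
    T.toFinset.card ≤ assertionBound A.size := by
  obtain ⟨N, hN, hNA⟩ := A.exists_finset_boundsTerm
  exact (Finset.card_le_card fun α hα =>
    hNA α (h.boundsTerm (List.mem_toFinset.1 hα))).trans hN

open Classical in
theorem Applicable.card_lt {T S : Tableau O F D} (h : Applicable E T S) :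
    T.toFinset.card < (S ++ T).toFinset.card := by
  obtain ⟨α, hαS, hαT⟩ : ∃ α ∈ S, α ∉ T := by simpa [List.subset_def] using h.2
  refine Finset.card_lt_card (Finset.ssubset_iff.2 ⟨α, by simpa using hαT, ?_⟩)
  intro β hβ
  rcases Finset.mem_insert.1 hβ with rfl | hβ
  · exact List.mem_toFinset.2 (List.mem_append_left _ hαS)
  · exact List.mem_toFinset.2 (List.mem_append_right _ (List.mem_toFinset.1 hβ))

variable [DecidableEq O] [DecidableEq F] [DecidableEq D]

theorem Run.invariant {T : Tableau O F D} {n : ℕ} (r : Run E A.toTab T n) : A.Invariant T := by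
  induction r with
  | start => exact A.invariant_toTab
  | step _ _ hS ih => exact ih.rule hS.1

open Classical in
-- Tableaux are lists and may repeat assertions, but a step adds at most two entries and at least
-- one new assertion, so the length is controlled by the number of distinct entries.
theorem Run.length_le {T : Tableau O F D} {n : ℕ} (r : Run E A.toTab T n) :
    T.length ≤ A.size + 2 * T.toFinset.card := by
  induction r with
  | start =>
    have := A.length_le_size
    simp only [ABox.toTab, List.length_map]
    omega
  | step _ _ hS ih =>
    have := hS.card_lt
    have := hS.1.length_le
    rw [List.length_append]
    omega

end

/-- A bound for the number of assertions in a tableau, counted with repetitions. -/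
def lengthBound {R : Type*} [CommSemiring R] (n : R) : R :=
  n + 2 * assertionBound n

/-- A bound for the number of elementary steps on an ABox of size `n`. -/
def stepBound {R : Type*} [CommSemiring R] (n : R) : R :=
  assertionBound n * (roundBound (lengthBound n) (12 * n + 4) + 2) +
    roundBound (lengthBound n) (12 * n + 4)

theorem roundBound_mono {N N' : ℕ} (h : N ≤ N') (s : ℕ) : roundBound N s ≤ roundBound N' s := by
  simp only [roundBound]
  gcongr

section

variable {O F D : Type} [DecidableEq O] [DecidableEq F] [DecidableEq D]
  {E : LocalInverse O F} {A : ABox O F D}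

theorem Run.roundT_cost_le {T : Tableau O F D} {n : ℕ} (r : Run E A.toTab T n) :
    (roundT E T).cost ≤ roundBound (lengthBound A.size) (12 * A.size + 4) := by
  refine (LEALC.roundT_cost_le E fun β hβ => (r.invariant.boundsTerm hβ).nodes_le).trans
    (roundBound_mono ?_ _)
  have h₁ := r.length_le
  have h₂ := r.invariant.card_le
  rw [lengthBound]
  omega

open Classical in
-- Each step is charged to a new distinct assertion; the summand 2 pays for writing the conclusions.
theorem Run.cost_le {T : Tableau O F D} {n : ℕ} (r : Run E A.toTab T n) :
    n ≤ T.toFinset.card * (roundBound (lengthBound A.size) (12 * A.size + 4) + 2) := by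
  induction r with
  | start => exact Nat.zero_le _
  | step r _ hS ih =>
    refine le_trans ?_ (Nat.mul_le_mul_right _ (Nat.succ_le_of_lt hS.card_lt))
    have := r.roundT_cost_le
    have := hS.1.length_le
    rw [Nat.succ_mul]
    omega

theorem Run.total_cost_le {T : Tableau O F D} {n : ℕ} (r : Run E A.toTab T n) :
    n + (roundT E T).cost ≤ stepBound A.size := by
  classical
  exact Nat.add_le_add (r.cost_le.trans (Nat.mul_le_mul_right _ r.invariant.card_le))
    r.roundT_cost_le

theorem Run.exists_halts {T : Tableau O F D} {n : ℕ} (r : Run E A.toTab T n) :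
    ∃ T' m ans, Run E T T' m ∧ Halts E T' ans := by
  classical
  -- The measure is the number of distinct assertions still available. The run from the ABox
  -- supplies the bound, the run from T is the one being extended, so both are carried along.
  suffices h : ∀ k (T' : Tableau O F D) (n' m : ℕ), Run E A.toTab T' n' → Run E T T' m →
      assertionBound A.size - T'.toFinset.card = k →
      ∃ T' m ans, Run E T T' m ∧ Halts E T' ans from h _ T n 0 r .start rfl
  intro k
  induction k using Nat.strong_induction_on with
  | _ k ih =>
    intro T' n' m r' r'' hk
    by_cases hc : HasClash T'
    · exact ⟨T', m, _, r'', .clash hc⟩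
    by_cases hS : ∃ S, Applicable E T' S
    · obtain ⟨S, hS⟩ := hS
      have r₁ := r'.step hc hS
      have h₁ := hS.card_lt
      have h₂ := r₁.invariant.card_le
      exact ih _ (by omega) _ _ _ r₁ (r''.step hc hS) rfl
    · exact ⟨T', m, _, r'', .complete hc (not_exists.1 hS)⟩

end

end LEALC

open LEALC

theorem mainTheorem4 :
    ∃ p : Polynomial ℕ, ∀ (O F D : Type) [DecidableEq O] [DecidableEq F] [DecidableEq D]
      (E : LocalInverse O F) (A : ABox O F D),
      -- every run, with any choice of rules, spends at most `p(|A|)` elementary steps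
      (∀ T n, Run E A.toTab T n → n + (roundT E T).cost ≤ p.eval A.size) ∧
      -- every run can be continued until it halts
      (∀ T n, Run E A.toTab T n → ∃ T' m ans, Run E T T' m ∧ Halts E T' ans) ∧
      -- the answer of every halting run is correct
      (∀ T n ans, Run E A.toTab T n → Halts E T ans →
        (ans = .consistent ↔ Consistent E A)) := by
  refine ⟨stepBound Polynomial.X, fun O F D _ _ _ E A =>
    ⟨fun T n r => ?_, fun T n r => r.exists_halts, fun T n ans r h => r.answer_correct h⟩⟩
  -- The bounds are expressions over any commutative semiring, so the required polynomial is their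
  -- value at X, and evaluating it recovers the numerical bound.
  have h (n : ℕ) : (stepBound (Polynomial.X : Polynomial ℕ)).eval n = stepBound n := by
    simp [stepBound, lengthBound, assertionBound, nameBound, roundBound]
  rw [h]
  exact r.total_cost_le
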